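/- \textbf{Setting.} Let $\Omega\subseteq\mathbb R^n$ be open and let $I\ni 0$ be an open interval. Let $\gamma:I\times\Omega\to\mathbb R^n$, $(t,x)\mapsto\gamma_t(x)$, be $C^\infty$, such that $\gamma_0=\mathrm{id}$ and every $\gamma_t$ is a diffeomorphism of $\Omega$ onto its image. For a vector field $V$ on $\Omega$ let $\exp(V)(x)$ be the value at time $1$ of the integral curve of $V$ in $\Omega$ starting at $x$. Let $N\ge n$ and let $X_1,\dots,X_N$ be $C^\infty$ vector fields on $\Omega$ such that for every $x\in\Omega$ $$\gamma_t(x)=\exp\Big(\sum_{i=1}^N t^iX_i\Big)(x)+O(|t|^{N+1})\qquad (t\to0).$$ \textbf{Pullback condition.} For $x\in\Omega$ and $t$ near $0$ put $\Gamma_R(x,t)=\frac{d}{ds}\big(\gamma_{s+t}\circ\gamma_t^{-1}(x)\big)\big|_{s=0}$. Condition $(P)_R$ holds at $x$ if the vectors $(\partial/\partial t)^\nu\Gamma_R(x,0)$, $\nu=0,\dots,n-1$, are linearly independent. \textbf{Bracket condition.} For a word $w=(w_1,\dots,w_m)$ in the letters $1,2$ let $c_w$ be $\frac1m$ times the coefficient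 of $C_{w_1}\cdots C_{w_m}$ in the noncommutative power series $\log(e^{A}e^{B})$, where $C_1=A$, $C_2=B$; thus $\log(e^Ae^B)=\sum_w c_w\,\mathrm{ad}(C_{w_1})\cdots\mathrm{ad}(C_{w_{m-1}})C_{w_m}$ is the Campbell--Hausdorff formula. For $J\in\{1,2\}^{m-2}$ let $\tilde c_J=c_{(J,1,2)}-c_{(J,2,1)}$. For $k\ge1$, $m\ge2$ and $I=(i_1,\dots,i_m)$ with $i_l\ge1$ let $$a_{I,k}=-\frac{i_m-i_{m-1}}{k}\sum_{J\in\{1,2\}^{m-2}}(-1)^{j_1+\dots+j_{m-2}}\,\tilde c_J\quad\text{if } i_1+\dots+i_m=k\text{ and } i_{m-1}<i_m,$$ and $a_{I,k}=0$ otherwise. These are universal rational numbers. With the usual Lie bracket of vector fields ($[V,W]=VW-WV$ as derivations) put $$\widehat X_k=X_k+\sum_{m=2}^{k-1}\ \sum_{I=(i_1,\dots,i_m)}a_{I,k}\,[X_{i_1},[X_{i_2},\dots,[X_{i_{m-1}},X_{i_m}]\dots]].$$ Condition $(B)_R$ holds at $x$ if the vectors $\widehat X_1(x),\dots,\widehat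 X_n(x)$ are linearly independent. \textbf{Proposition.} For every $x\in\Omega$, condition $(P)_R$ holds at $x$ if and only if condition $(B)_R$ holds at $x$. Moreover $\widehat X_1=X_1$, $\widehat X_2=X_2$, and $$\begin{aligned} \widehat X_3&=X_3-\tfrac16[X_1,X_2],\\ \widehat X_4&=X_4-\tfrac14[X_1,X_3]+\tfrac1{24}[X_1,[X_1,X_2]],\\ \widehat X_5&=X_5-\tfrac3{10}[X_1,X_4]-\tfrac1{10}[X_2,X_3]+\tfrac1{15}[X_1,[X_1,X_3]]+\tfrac1{30}[X_2,[X_1,X_2]]-\tfrac1{120}[X_1,[X_1,[X_1,X_2]]]. \end{aligned}$$ -/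

import Mathlib

open Set Filter Topology
open scoped ContDiff Nat

noncomputable section

namespace CurveFamily

/-! ### Coefficients of the Campbell-Hausdorff formula

The two letters `0` and `1` stand for the noncommuting variables `A` and `B`. -/

/-- The free associative `ℚ`-algebra on the two letters, with the words as its basis. -/
abbrev WordAlgebra : Type := MonoidAlgebra ℚ (FreeMonoid (Fin 2))

/-- A letter as an element of the free algebra. -/
def letter (j : Fin 2) : WordAlgebra := MonoidAlgebra.of ℚ (FreeMonoid (Fin 2)) (FreeMonoid.of j)

/-- The series `exp A * exp B = ∑ A ^ p * B ^ q / (p! q!)`, truncated to `p, q ≤ d`. -/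
def expMulExp (d : ℕ) : WordAlgebra :=
  ∑ p ∈ Finset.range (d + 1), ∑ q ∈ Finset.range (d + 1),
    ((p ! : ℚ) * (q ! : ℚ))⁻¹ • (letter 0 ^ p * letter 1 ^ q)

/-- The series `log (exp A * exp B)`; it is correct on all words of length at most `d`, since
`exp A * exp B - 1` has no constant term. -/
def logExpMulExp (d : ℕ) : WordAlgebra :=
  ∑ r ∈ Finset.Icc 1 d, ((-1 : ℚ) ^ (r - 1) / (r : ℚ)) • (expMulExp d - 1) ^ r

/-- The coefficient `c_w` in the explicit (Dynkin) form of the Campbell-Hausdorff formula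
`log (exp A * exp B) = ∑_w c_w ad(C_{w_1}) ⋯ ad(C_{w_{m-1}}) C_{w_m}`, `C_0 = A`, `C_1 = B`:
the coefficient of the word `w` in `log (exp A * exp B)`, divided by the length of `w`. -/
def chCoeff (w : List (Fin 2)) : ℚ :=
  (logExpMulExp w.length).coeff (FreeMonoid.ofList w) / (w.length : ℚ)

/-- The coefficient `c̃_J = c_{(J, A, B)} - c_{(J, B, A)}` of `ad(C_{j_1}) ⋯ ad(C_{j_m}) [A, B]`
in the Campbell-Hausdorff formula. -/
def chCommCoeff {m : ℕ} (J : Fin m → Fin 2) : ℚ :=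
  chCoeff (List.ofFn J ++ [0, 1]) - chCoeff (List.ofFn J ++ [1, 0])

/-- `∑_J ± c̃_J` over all `J` of length `m`, with one factor `-1` for each letter `A` in `J`. -/
def chSignedSum (m : ℕ) : ℚ :=
  ∑ J : Fin m → Fin 2, (-1) ^ (∑ l, ((J l : ℕ) + 1)) * chCommCoeff J

/-- The universal coefficient `a_{I,k}` of the bracket
`[X_{i_1}, [X_{i_2}, …, [X_{i_{m+1}}, X_{i_{m+2}}]…]]`, for `I = (i_1, …, i_{m+2})`. -/
def bracketCoeff (k : ℕ) {m : ℕ} (I : Fin (m + 2) → ℕ) : ℚ :=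
  if ∑ l, I l = k ∧ I (Fin.last m).castSucc < I (Fin.last (m + 1)) then
    -(chSignedSum m * ((I (Fin.last (m + 1)) : ℚ) - (I (Fin.last m).castSucc : ℚ)) / (k : ℚ))
  else 0

/-! ### Vector fields on `ℝⁿ` and the bracket condition -/

variable {n : ℕ}

/-- The right-nested iterated Lie bracket `[X_{i_1}, [X_{i_2}, …, [X_{i_{m-1}}, X_{i_m}]…]]`. -/
def nestedBracket (X : ℕ → EuclideanSpace ℝ (Fin n) → EuclideanSpace ℝ (Fin n)) :
    List ℕ → EuclideanSpace ℝ (Fin n) → EuclideanSpace ℝ (Fin n)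
  | [] => 0
  | [i] => X i
  | i :: j :: l => VectorField.lieBracket ℝ (X i) (nestedBracket X (j :: l))

/-- The vector field `X̂_k = X_k + ∑_{m=2}^{k-1} ∑_{I = (i_1, …, i_m)} a_{I,k} [X_{i_1}, …]`
(in the sum, `m` is the length of `I` minus two). -/
def hatField (X : ℕ → EuclideanSpace ℝ (Fin n) → EuclideanSpace ℝ (Fin n)) (k : ℕ) :
    EuclideanSpace ℝ (Fin n) → EuclideanSpace ℝ (Fin n) :=
  X k + ∑ m ∈ Finset.range (k - 2),
    ∑ I ∈ Fintype.piFinset (fun _ : Fin (m + 2) => Finset.Icc 1 k),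
      (bracketCoeff k I : ℝ) • nestedBracket X (List.ofFn I)

/-- The bracket condition `(B)_R` at `x`: the vectors `X̂_1(x), …, X̂_n(x)` are linearly
independent. -/
def BracketCondition (X : ℕ → EuclideanSpace ℝ (Fin n) → EuclideanSpace ℝ (Fin n))
    (x : EuclideanSpace ℝ (Fin n)) : Prop :=
  LinearIndependent ℝ (fun k : Fin n => hatField X ((k : ℕ) + 1) x)

/-! ### Families of curves and the pullback condition -/

/-- `γ` is a smooth one-parameter family, with parameter in the open interval `I` around `0`, of
diffeomorphisms `γ t` of the open set `Ω ⊆ ℝⁿ` onto their images, with `γ 0 = id`. -/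
structure IsDiffeoFamily (Ω : Set (EuclideanSpace ℝ (Fin n))) (I : Set ℝ)
    (γ : ℝ → EuclideanSpace ℝ (Fin n) → EuclideanSpace ℝ (Fin n)) : Prop where
  isOpen_domain : IsOpen Ω
  isOpen_interval : IsOpen I
  ordConnected : I.OrdConnected
  zero_mem : (0 : ℝ) ∈ I
  smooth : ContDiffOn ℝ ∞ (fun p : ℝ × EuclideanSpace ℝ (Fin n) => γ p.1 p.2) (I ×ˢ Ω)
  injOn : ∀ t ∈ I, InjOn (γ t) Ω
  fderiv_invertible : ∀ t ∈ I, ∀ x ∈ Ω, (fderiv ℝ (γ t) x).IsInvertible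
  map_zero : ∀ x ∈ Ω, γ 0 x = x

/-- `y = exp(V)(x)`: the point `y` is reached at time one by the integral curve in `Ω` of the
vector field `V` that starts at `x`. -/
def IsExp (Ω : Set (EuclideanSpace ℝ (Fin n)))
    (V : EuclideanSpace ℝ (Fin n) → EuclideanSpace ℝ (Fin n))
    (x y : EuclideanSpace ℝ (Fin n)) : Prop :=
  ∃ u : ℝ → EuclideanSpace ℝ (Fin n), u 0 = x ∧ u 1 = y ∧ (∀ τ ∈ Icc (0 : ℝ) 1, u τ ∈ Ω) ∧
    IsIntegralCurveOn u (fun _ => V) (Icc 0 1)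

/-- `γ_t(x) = exp(∑_{i=1}^N t^i X_i)(x) mod O(t^{N+1})` as `t → 0`, for every `x ∈ Ω`. -/
def IsExpModulo (Ω : Set (EuclideanSpace ℝ (Fin n)))
    (γ : ℝ → EuclideanSpace ℝ (Fin n) → EuclideanSpace ℝ (Fin n))
    (X : ℕ → EuclideanSpace ℝ (Fin n) → EuclideanSpace ℝ (Fin n)) (N : ℕ) : Prop :=
  ∀ x ∈ Ω, ∃ C : ℝ, ∀ᶠ t : ℝ in 𝓝 0, ∃ y : EuclideanSpace ℝ (Fin n),
    IsExp Ω (fun z => ∑ i ∈ Finset.Icc 1 N, t ^ i • X i z) x y ∧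
      ‖γ t x - y‖ ≤ C * |t| ^ (N + 1)

/-- The curve `Γ_R(x, t) = d/ds (γ_{s+t} ∘ γ_t⁻¹ (x))` at `s = 0`. The point `x ∈ Ω` lies in the
image `γ_t(Ω)`, so that the inverse is the true one, for all small `t`. -/
def GammaR (Ω : Set (EuclideanSpace ℝ (Fin n)))
    (γ : ℝ → EuclideanSpace ℝ (Fin n) → EuclideanSpace ℝ (Fin n))
    (x : EuclideanSpace ℝ (Fin n)) (t : ℝ) : EuclideanSpace ℝ (Fin n) :=
  deriv (fun s : ℝ => γ (s + t) (Function.invFunOn (γ t) Ω x)) 0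

/-- The pullback condition `(P)_R` at `x`: the vectors `(∂/∂t)^ν Γ_R(x, 0)`, `ν = 0, …, n - 1`,
are linearly independent. -/
def PullbackCondition (Ω : Set (EuclideanSpace ℝ (Fin n)))
    (γ : ℝ → EuclideanSpace ℝ (Fin n) → EuclideanSpace ℝ (Fin n))
    (x : EuclideanSpace ℝ (Fin n)) : Prop :=
  LinearIndependent ℝ (fun ν : Fin n => iteratedDeriv (ν : ℕ) (GammaR Ω γ x) 0)

end CurveFamily

end

open Set Filter Topology
open scoped ContDiff Nat

noncomputable section

namespace CurveFamily

/-! ### The signed sums of the Campbell-Hausdorff coefficients -/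

section CampbellHausdorff

open Finset

variable {R : Type*} [CommRing R]

/-! The family satisfies `∂_t γ_t(x) = W(t, γ_t(x))` for a smooth time-dependent field `W`, and for
`t` near 0 the curve `Γ_R(x, t)` is just `W(t, x)` (`IsDiffeoFamily.exists_velocity`). So the task
is to compute the Taylor coefficients `w_j` of `W` at `t = 0`.

Let vector fields act on smooth maps as derivations, and put `V(t) = ∑ t^i X_i`. Modulo `t^(N+1)`,
composition with `γ_t` is the operator `E(t) = exp V(t)` (`hasExpansion_of_isExpModulo`). Applied to
the identity map, the flow equation becomes `E'(t) id = E(t) W(t)`; comparing coefficients yields a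
recursion for the `w_j` (`IsDiffeoFamily.succ_smul_coeff_eq_sum`). On the other hand `E' = E L`
holds in any noncommutative ring, with `L = ∑_q (-ad V)^q V' / (q+1)!` (`coeff_derivative_expTrunc`,
up to truncation). Hence the coefficients of `L id` obey the same recursion. It is triangular
because `E(0) = 1`, so `w_j = L_j id` for `j < N`.

Expanding `L` gives nested commutators weighted by their last index; antisymmetry of the innermost
commutator turns that weight into the difference of the last two indices. The outcome is `L_(k-1) =
k X̂_k` (`coeff_logDerivTrunc`), provided that the signed sum of Campbell-Hausdorff coefficients in
`a_{I,k}` equals `(-1)^m / (m+2)!`. This is `chSignedSum_eq`, proved by evaluating `log (e^A e^B)`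
in a representation by 4×4 matrices in which `e^A e^B - 1` squares to zero.

Altogether the `ν`-th derivative of `Γ_R` at 0 is `(ν+1)! X̂_(ν+1)` (`iteratedDeriv_GammaR`), and
nonzero factors do not affect linear independence. -/

/-- Matrices, one for each letter, whose products compute the signed sums of coefficients. -/
def letterMatrix (z : R) (j : Fin 2) : Matrix (Fin 4) (Fin 4) R :=
  if j = 0 then !![-z, z, 0, 0; 0, 0, 0, 0; 0, 0, 0, -z; 0, 0, 0, 0]
  else !![z, 0, z, 0; 0, 0, 0, z; 0, 0, 0, 0; 0, 0, 0, 0]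

lemma letterMatrix_zero_pow (z : R) (p : ℕ) :
    letterMatrix z 0 ^ p = !![(-z) ^ p, (if p = 0 then 1 else 0) - (-z) ^ p, 0, 0;
      0, if p = 0 then 1 else 0, 0, 0;
      0, 0, if p = 0 then 1 else 0, if p = 1 then -z else 0;
      0, 0, 0, if p = 0 then 1 else 0] := by
  induction p with
  | zero => ext i j; fin_cases i <;> fin_cases j <;> simp
  | succ p ih =>
    rw [pow_succ', ih]
    rcases p with _ | p <;> ext i j <;> fin_cases i <;> fin_cases j <;>
      simp [letterMatrix, Matrix.mul_apply, Fin.sum_univ_four] <;> ring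

lemma letterMatrix_one_pow (z : R) (p : ℕ) :
    letterMatrix z 1 ^ p = !![z ^ p, 0, z ^ p - (if p = 0 then 1 else 0), 0;
      0, if p = 0 then 1 else 0, 0, if p = 1 then z else 0;
      0, 0, if p = 0 then 1 else 0, 0;
      0, 0, 0, if p = 0 then 1 else 0] := by
  induction p with
  | zero => ext i j; fin_cases i <;> fin_cases j <;> simp
  | succ p ih =>
    rw [pow_succ', ih]
    rcases p with _ | p <;> ext i j <;> fin_cases i <;> fin_cases j <;>
      simp [letterMatrix, Matrix.mul_apply, Fin.sum_univ_four] <;> ring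

variable [Algebra ℚ R]

/-- The exponential series truncated after the power `d`. -/
def truncExp (d : ℕ) (z : R) : R := ∑ p ∈ range (d + 1), (p ! : ℚ)⁻¹ • z ^ p

lemma truncExp_neg_mul {d : ℕ} {z : R} (hz : z ^ (d + 1) = 0) :
    truncExp d (-z) * truncExp d z = 1 := by
  have hz' : (-z) ^ (d + 1) = 0 := by rw [neg_pow, hz, mul_zero]
  rw [truncExp, truncExp, ← IsNilpotent.exp_eq_sum hz, ← IsNilpotent.exp_eq_sum hz']
  exact IsNilpotent.exp_neg_mul_exp_self ⟨_, hz⟩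

lemma sum_smul_letterMatrix_zero_pow (z : R) {d : ℕ} (hd : 1 ≤ d) :
    ∑ p ∈ range (d + 1), (p ! : ℚ)⁻¹ • letterMatrix z 0 ^ p =
      !![truncExp d (-z), 1 - truncExp d (-z), 0, 0; 0, 1, 0, 0; 0, 0, 1, -z; 0, 0, 0, 1] := by
  have h1 : 1 < d + 1 := by omega
  ext i j
  rw [Matrix.sum_apply]
  fin_cases i <;> fin_cases j <;>
    simp [letterMatrix_zero_pow, truncExp, smul_sub, smul_ite, Finset.sum_ite_eq', h1]

lemma sum_smul_letterMatrix_one_pow (z : R) {d : ℕ} (hd : 1 ≤ d) :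
    ∑ p ∈ range (d + 1), (p ! : ℚ)⁻¹ • letterMatrix z 1 ^ p =
      !![truncExp d z, 0, truncExp d z - 1, 0; 0, 1, 0, z; 0, 0, 1, 0; 0, 0, 0, 1] := by
  have h1 : 1 < d + 1 := by omega
  ext i j
  rw [Matrix.sum_apply]
  fin_cases i <;> fin_cases j <;>
    simp [letterMatrix_one_pow, truncExp, smul_sub, smul_ite, Finset.sum_ite_eq', h1]

/-- The representation of the free algebra by the matrices `letterMatrix`. -/
def wordRep (z : R) : WordAlgebra →ₐ[ℚ] Matrix (Fin 4) (Fin 4) R :=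
  MonoidAlgebra.lift ℚ _ _ (FreeMonoid.lift (letterMatrix z))

lemma wordRep_letter (z : R) (j : Fin 2) : wordRep z (letter j) = letterMatrix z j := by
  simp [wordRep, letter]

lemma wordRep_of (z : R) (l : List (Fin 2)) :
    wordRep z (MonoidAlgebra.of ℚ _ (FreeMonoid.ofList l)) = (l.map (letterMatrix z)).prod := by
  simp [wordRep, FreeMonoid.lift_apply]

/-- In this representation `e^A e^B - 1` has square zero, so the logarithm stops after its linear
term and one matrix entry can be read off. Nilpotency of `z` makes the truncated exponentials of `z`
and `-z` inverse to each other. -/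
lemma wordRep_logExpMulExp {d : ℕ} (hd : 1 ≤ d) {z : R} (hz : z ^ (d + 1) = 0) :
    wordRep z (logExpMulExp d) 0 3 = z * (1 - truncExp d (-z)) := by
  have hE : wordRep z (expMulExp d) =
      (∑ p ∈ range (d + 1), (p ! : ℚ)⁻¹ • letterMatrix z 0 ^ p) *
        ∑ p ∈ range (d + 1), (p ! : ℚ)⁻¹ • letterMatrix z 1 ^ p := by
    simp only [expMulExp, map_sum, map_smul, map_mul, map_pow, wordRep_letter, Finset.sum_mul_sum,
      mul_inv, smul_mul_smul_comm]
  have h1 := truncExp_neg_mul hz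
  have hN : wordRep z (expMulExp d - 1) =
      !![0, 1 - truncExp d (-z), 1 - truncExp d (-z), z * (1 - truncExp d (-z)); 0, 0, 0, z; 0, 0, 0, -z; 0, 0, 0, 0] := by
    rw [map_sub, map_one, hE, sum_smul_letterMatrix_zero_pow z hd,
      sum_smul_letterMatrix_one_pow z hd]
    ext i j
    fin_cases i <;> fin_cases j <;> simp [mul_sub, h1]
    ring
  -- The only possible contribution is the entry `(0, 3)`, where the paths through states 1 and 2
  -- cancel.
  have hN2 : wordRep z (expMulExp d - 1) ^ 2 = 0 := by
    rw [hN, pow_two]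
    ext i j
    fin_cases i <;> fin_cases j <;> simp [Matrix.mul_apply, Fin.sum_univ_four]
  rw [logExpMulExp, map_sum, Finset.sum_eq_single_of_mem 1 (by simp [hd])]
  · rw [map_smul, map_pow, hN]
    simp
  · intro r hr hr1
    obtain ⟨s, rfl⟩ : ∃ s, r = 2 + s := ⟨r - 2, by have := (Finset.mem_Icc.1 hr).1; omega⟩
    rw [map_smul, map_pow, pow_add, hN2, zero_mul, smul_zero]

/-- The linear functional on words `∑_J ± (w_{(J, A, B)} - w_{(J, B, A)})`. -/
def signedIndicator (m : ℕ) (l : List (Fin 2)) : ℚ :=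
  ∑ J : Fin m → Fin 2, (-1) ^ (∑ i, ((J i : ℕ) + 1)) *
    ((if l = List.ofFn J ++ [0, 1] then 1 else 0) - if l = List.ofFn J ++ [1, 0] then 1 else 0)

lemma signedIndicator_succ_nil (m : ℕ) : signedIndicator (m + 1) [] = 0 := by
  simp [signedIndicator]

lemma signedIndicator_succ_cons (m : ℕ) (x : Fin 2) (l : List (Fin 2)) :
    signedIndicator (m + 1) (x :: l) = (-1) ^ ((x : ℕ) + 1) * signedIndicator m l := by
  rw [signedIndicator, ← (Fin.consEquiv fun _ : Fin (m + 1) => Fin 2).sum_comp,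
    Fintype.sum_prod_type, Finset.sum_eq_single_of_mem x (Finset.mem_univ _)]
  · simp [signedIndicator, Finset.mul_sum, Fin.sum_univ_succ, Fin.consEquiv, pow_add, List.ofFn_succ,
      mul_assoc]
  · intro y _ hy
    simp [Fin.consEquiv, List.ofFn_succ, Ne.symm hy]

-- The matrices form a weighted automaton. State 0 reads the prefix `J`, with weight `-z` for each
-- `A` and `z` for each `B`; the final state 3 is reached either through state 1 by reading `A B`,
-- with weight `z^2`, or through state 2 by reading `B A`, with weight `-z^2`. The exponent of `z`
-- records the length of the word.
open Polynomial in
lemma coeff_wordProd (m : ℕ) (l : List (Fin 2)) :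
    ((l.map (letterMatrix (X : ℚ[X]))).prod 0 3).coeff (m + 2) = signedIndicator m l := by
  have h33 : ∀ l : List (Fin 2), (l.map (letterMatrix (X : ℚ[X]))).prod 3 3 =
      if l = [] then 1 else 0 := by
    rintro (_ | ⟨x, l⟩)
    · simp
    · fin_cases x <;> simp [letterMatrix, Matrix.mul_apply, Fin.sum_univ_four]
  have h13 : ∀ l : List (Fin 2), (l.map (letterMatrix (X : ℚ[X]))).prod 1 3 =
      if l = [1] then X else 0 := by
    rintro (_ | ⟨x, l⟩)
    · simp
    · fin_cases x <;> simp [letterMatrix, Matrix.mul_apply, Fin.sum_univ_four, h33]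
  have h23 : ∀ l : List (Fin 2), (l.map (letterMatrix (X : ℚ[X]))).prod 2 3 =
      if l = [0] then -X else 0 := by
    rintro (_ | ⟨x, l⟩)
    · simp
    · fin_cases x <;> simp [letterMatrix, Matrix.mul_apply, Fin.sum_univ_four, h33]
  have hc0 : ∀ l : List (Fin 2), (l.map (letterMatrix (X : ℚ[X]))).prod 0 3 =
      match l with
      | [] => 0
      | x :: l => if x = 0 then
          X * (-(l.map (letterMatrix (X : ℚ[X]))).prod 0 3 + if l = [1] then X else 0) else
          X * ((l.map (letterMatrix (X : ℚ[X]))).prod 0 3 + if l = [0] then -X else 0) := by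
    rintro (_ | ⟨x, l⟩)
    · simp
    · fin_cases x <;> simp [letterMatrix, Matrix.mul_apply, Fin.sum_univ_four, h13, h23] <;>
        split_ifs <;> ring
  have hc1 : ∀ l : List (Fin 2), ((l.map (letterMatrix (X : ℚ[X]))).prod 0 3).coeff 1 = 0 := by
    have h0 : ∀ l : List (Fin 2), ((l.map (letterMatrix (X : ℚ[X]))).prod 0 3).coeff 0 = 0 := by
      rintro (_ | ⟨x, l⟩)
      · simp
      · rw [hc0]; fin_cases x <;> simp
    rintro (_ | ⟨x, l⟩)
    · simp
    · rw [hc0]; fin_cases x <;> simp [coeff_X_mul, h0, apply_ite (fun p : ℚ[X] => coeff p 0)]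
  induction m generalizing l with
  | zero =>
    rcases l with _ | ⟨x, l⟩
    · simp [signedIndicator]
    · rw [hc0]
      fin_cases x <;>
        simp [signedIndicator, coeff_X_mul, hc1, apply_ite (fun p : ℚ[X] => coeff p 1)]
      split_ifs <;> simp
  | succ m ih =>
    rcases l with _ | ⟨x, l⟩
    · simp [signedIndicator_succ_nil]
    · rw [hc0, signedIndicator_succ_cons, ← ih]
      fin_cases x <;>
        simp [coeff_X_mul, coeff_X, apply_ite (fun p : ℚ[X] => coeff p (m + 2))]

open Polynomial in
lemma coeff_wordRep (m : ℕ) (a : WordAlgebra) :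
    (wordRep (X : ℚ[X]) a 0 3).coeff (m + 2) =
      ∑ J : Fin m → Fin 2, (-1) ^ (∑ i, ((J i : ℕ) + 1)) *
        (a.coeff (FreeMonoid.ofList (List.ofFn J ++ [0, 1])) -
          a.coeff (FreeMonoid.ofList (List.ofFn J ++ [1, 0]))) := by
  induction a using MonoidAlgebra.induction_on with
  | of w =>
    obtain ⟨l, rfl⟩ := FreeMonoid.ofList.surjective w
    rw [wordRep_of, coeff_wordProd, signedIndicator]
    have h : ∀ l' : List (Fin 2), Finsupp.single (FreeMonoid.ofList l) (1 : ℚ)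
        (FreeMonoid.ofList l') = if l = l' then 1 else 0 := by
      classical
      intro l'
      rw [Finsupp.single_apply]
      simp only [FreeMonoid.ofList.injective.eq_iff]
    simp only [MonoidAlgebra.of_apply, MonoidAlgebra.coeff_single, h]
  | add a b ha hb =>
    simp only [map_add, Matrix.add_apply, coeff_add, ha, hb, ← Finset.sum_add_distrib,
      MonoidAlgebra.coeff_add, Finsupp.add_apply]
    exact Finset.sum_congr rfl fun J _ => by ring
  | smul r a ha =>
    simp only [map_smul, Matrix.smul_apply, coeff_smul, ha, Finset.mul_sum, smul_eq_mul,
      MonoidAlgebra.coeff_smul, Finsupp.smul_apply]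
    exact Finset.sum_congr rfl fun J _ => by ring

-- Naturality in the parameter: it transports the computation from `ℚ[X]`, where coefficients can be
-- read, to a quotient where `X` is nilpotent.
open Polynomial in
lemma map_wordRep {S : Type*} [CommRing S] [Algebra ℚ S] (f : ℚ[X] →ₐ[ℚ] S) (a : WordAlgebra) :
    f (wordRep (X : ℚ[X]) a 0 3) = wordRep (f X) a 0 3 := by
  have : (f.mapMatrix (m := Fin 4)).comp (wordRep (X : ℚ[X])) = wordRep (f X) := by
    refine MonoidAlgebra.algHom_ext' ?_ (by ext)
    refine FreeMonoid.hom_eq fun j => ?_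
    change f.mapMatrix (wordRep X (letter j)) = wordRep (f X) (letter j)
    rw [wordRep_letter, wordRep_letter]
    ext i k
    fin_cases j <;> fin_cases i <;> fin_cases k <;> simp [letterMatrix]
  rw [← this]
  rfl

open Polynomial in
/-- The value of the signed sums of coefficients. -/
theorem chSignedSum_eq (m : ℕ) : chSignedSum m = (-1) ^ m / ((m + 2)! : ℚ) := by
  have key : (wordRep (X : ℚ[X]) (logExpMulExp (m + 2)) 0 3).coeff (m + 2) =
      (X * (1 - truncExp (m + 2) (-X : ℚ[X]))).coeff (m + 2) := by
    -- Modulo `X ^ (m + 3)` the parameter is nilpotent, while the coefficient of `X ^ (m + 2)` is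
    -- still visible.
    let Q := ℚ[X] ⧸ Ideal.span {(X : ℚ[X]) ^ (m + 3)}
    let f : ℚ[X] →ₐ[ℚ] Q := Ideal.Quotient.mkₐ ℚ _
    have hz : f X ^ (m + 2 + 1) = 0 := by
      rw [← map_pow]
      exact Ideal.Quotient.eq_zero_iff_mem.2 (Ideal.mem_span_singleton_self _)
    have h : f (wordRep (X : ℚ[X]) (logExpMulExp (m + 2)) 0 3) =
        f (X * (1 - truncExp (m + 2) (-X : ℚ[X]))) := by
      rw [map_wordRep, wordRep_logExpMulExp (by omega) hz]
      simp [truncExp]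
    have h2 := Ideal.mem_span_singleton.1 (Ideal.Quotient.eq.1 h)
    have h3 := X_pow_dvd_iff.1 h2 (m + 2) (by omega)
    rwa [coeff_sub, sub_eq_zero] at h3
  -- All words involved have length `m + 2`, so the Dynkin factor `1 / length` is common to the
  -- whole sum.
  have h1 : chSignedSum m = (wordRep (X : ℚ[X]) (logExpMulExp (m + 2)) 0 3).coeff (m + 2) /
      ((m : ℚ) + 2) := by
    rw [coeff_wordRep, chSignedSum, Finset.sum_div]
    refine Finset.sum_congr rfl fun J _ => ?_
    simp only [chCommCoeff, chCoeff, List.length_append, List.length_ofFn, List.length_cons,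
      List.length_nil]
    push_cast
    ring
  rw [h1, key, coeff_X_mul, coeff_sub, coeff_one, if_neg (by omega), truncExp, finsetSum_coeff,
    Finset.sum_eq_single_of_mem (m + 1) (by simp)]
  · rw [coeff_smul, neg_pow, ← C_1, ← C_neg, ← C_pow, coeff_C_mul_X_pow, if_pos rfl,
      Nat.factorial_succ (m + 1)]
    have := Nat.cast_ne_zero (R := ℚ).2 (Nat.factorial_ne_zero (m + 1))
    push_cast
    simp only [smul_eq_mul, pow_succ]
    field_simp
    ring
  · intro b _ hb
    rw [coeff_smul, neg_pow, ← C_1, ← C_neg, ← C_pow, coeff_C_mul_X_pow, if_neg (Ne.symm hb),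
      smul_zero]

end CampbellHausdorff

/-! ### The first modified fields -/

section ExplicitFormulas

variable {n : ℕ}

/-- Since `a_{I,k}` vanishes unless the indices sum to `k` and the last two increase, the explicit
formulas need only a short list of tuples. -/
lemma sum_bracketCoeff_smul_eq (X : ℕ → EuclideanSpace ℝ (Fin n) → EuclideanSpace ℝ (Fin n))
    (k m : ℕ) (s : Finset (Fin (m + 2) → ℕ)) (hs : ∀ I ∈ s, ∀ l, 1 ≤ I l ∧ I l ≤ k)
    (h : ∀ I : Fin (m + 2) → ℕ, (∀ l, 1 ≤ I l) → ∑ l, I l = k →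
      I (Fin.last m).castSucc < I (Fin.last (m + 1)) → I ∈ s) :
    ∑ I ∈ Fintype.piFinset (fun _ : Fin (m + 2) => Finset.Icc 1 k),
      (bracketCoeff k I : ℝ) • nestedBracket X (List.ofFn I) =
    ∑ I ∈ s, (bracketCoeff k I : ℝ) • nestedBracket X (List.ofFn I) := by
  symm
  refine Finset.sum_subset (fun I hI => ?_) fun I hI hIs => ?_
  · simpa [Fintype.mem_piFinset] using hs I hI
  · rw [bracketCoeff, if_neg, Rat.cast_zero, zero_smul]
    rintro ⟨h1, h2⟩
    simp only [Fintype.mem_piFinset, Finset.mem_Icc] at hI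
    exact hIs (h I (fun l => (hI l).1) h1 h2)

variable (X : ℕ → EuclideanSpace ℝ (Fin n) → EuclideanSpace ℝ (Fin n))
  (x : EuclideanSpace ℝ (Fin n))

lemma hatField_one : hatField X 1 x = X 1 x := by simp [hatField]

lemma hatField_two : hatField X 2 x = X 2 x := by simp [hatField]

lemma hatField_three : hatField X 3 x =
    X 3 x - (1 / 6 : ℝ) • VectorField.lieBracket ℝ (X 1) (X 2) x := by
  rw [hatField, Finset.sum_range_one, sum_bracketCoeff_smul_eq X 3 0 {![1, 2]}
    (by simp [Fin.forall_fin_two])]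
  · simp [bracketCoeff, chSignedSum_eq, nestedBracket, Nat.factorial]
    module
  · intro I h1 h2 h3
    have h1' := h1 0
    simp [Fin.sum_univ_succ] at h2 h3
    simp only [Finset.mem_singleton]
    ext l; fin_cases l <;> simp <;> omega

lemma hatField_four : hatField X 4 x =
    X 4 x - (1 / 4 : ℝ) • VectorField.lieBracket ℝ (X 1) (X 3) x + (1 / 24 : ℝ) •
      VectorField.lieBracket ℝ (X 1) (VectorField.lieBracket ℝ (X 1) (X 2)) x := by
  rw [hatField, Finset.sum_range_succ, Finset.sum_range_one,
    sum_bracketCoeff_smul_eq X 4 0 {![1, 3]} (by simp [Fin.forall_fin_two]),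
    sum_bracketCoeff_smul_eq X 4 1 {![1, 1, 2]} (by simp [Fin.forall_fin_succ])]
  · simp [bracketCoeff, chSignedSum_eq, nestedBracket, Nat.factorial, Fin.sum_univ_succ,
      Fin.last, Fin.castSucc, Fin.castAdd, Fin.castLE]
    module
  · intro I h1 h2 h3
    have h10 := h1 0
    have h11 := h1 1
    have h12 := h1 2
    simp [Fin.sum_univ_succ, Fin.last, Fin.castSucc, Fin.castAdd, Fin.castLE] at h2 h3
    simp only [Finset.mem_singleton]
    ext l; fin_cases l <;> simp <;> omega
  · intro I h1 h2 h3
    have h1' := h1 0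
    simp [Fin.sum_univ_succ] at h2 h3
    simp only [Finset.mem_singleton]
    ext l; fin_cases l <;> simp <;> omega

lemma hatField_five : hatField X 5 x =
    X 5 x - (3 / 10 : ℝ) • VectorField.lieBracket ℝ (X 1) (X 4) x
      - (1 / 10 : ℝ) • VectorField.lieBracket ℝ (X 2) (X 3) x
      + (1 / 15 : ℝ) • VectorField.lieBracket ℝ (X 1) (VectorField.lieBracket ℝ (X 1) (X 3)) x
      + (1 / 30 : ℝ) • VectorField.lieBracket ℝ (X 2) (VectorField.lieBracket ℝ (X 1) (X 2)) x
      - (1 / 120 : ℝ) • VectorField.lieBracket ℝ (X 1)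
          (VectorField.lieBracket ℝ (X 1) (VectorField.lieBracket ℝ (X 1) (X 2))) x := by
  rw [hatField, Finset.sum_range_succ, Finset.sum_range_succ, Finset.sum_range_one,
    sum_bracketCoeff_smul_eq X 5 0 {![1, 4], ![2, 3]} (by simp [Fin.forall_fin_succ]),
    sum_bracketCoeff_smul_eq X 5 1 {![1, 1, 3], ![2, 1, 2]} (by simp [Fin.forall_fin_succ]),
    sum_bracketCoeff_smul_eq X 5 2 {![1, 1, 1, 2]} (by simp [Fin.forall_fin_succ]),
    Finset.sum_pair (by decide), Finset.sum_pair (by decide), Finset.sum_singleton]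
  · simp [bracketCoeff, chSignedSum_eq, nestedBracket, Nat.factorial, Fin.sum_univ_succ,
      Fin.last, Fin.castSucc, Fin.castAdd, Fin.castLE]
    module
  · intro I h1 h2 h3
    have h10 := h1 0
    have h11 := h1 1
    have h12 := h1 2
    have h13 := h1 3
    simp [Fin.sum_univ_succ, Fin.last, Fin.castSucc, Fin.castAdd, Fin.castLE] at h2 h3
    simp only [Finset.mem_singleton]
    ext l; fin_cases l <;> simp <;> omega
  · intro I h1 h2 h3
    have h10 := h1 0
    have h11 := h1 1
    have h12 := h1 2
    simp [Fin.sum_univ_succ, Fin.last, Fin.castSucc, Fin.castAdd, Fin.castLE] at h2 h3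
    simp only [Finset.mem_insert, Finset.mem_singleton]
    -- The first index determines the tuple.
    have h : I 0 = 1 ∨ I 0 = 2 := by omega
    refine h.imp (fun h => ?_) fun h => ?_ <;>
    · ext l; fin_cases l <;> simp <;> omega
  · intro I h1 h2 h3
    have h10 := h1 0
    simp [Fin.sum_univ_succ] at h2 h3
    simp only [Finset.mem_insert, Finset.mem_singleton]
    have h : I 0 = 1 ∨ I 0 = 2 := by omega
    refine h.imp (fun h => ?_) fun h => ?_ <;>
    · ext l; fin_cases l <;> simp <;> omega

end ExplicitFormulas

/-! ### The logarithmic derivative of an exponential in a noncommutative ring -/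

section NoncommutativeAlgebra

open Finset Polynomial

variable {A : Type*} [Ring A]

/-- The iterated commutators `(-ad V)^q V'`. -/
def iterComm (V : A[X]) (q : ℕ) : A[X] := (fun W => W * V - V * W)^[q] (derivative V)

lemma iterComm_succ (V : A[X]) (q : ℕ) :
    iterComm V (q + 1) = iterComm V q * V - V * iterComm V q :=
  Function.iterate_succ_apply' _ _ _

/-- This is the Leibniz rule with all powers of `V` moved to the left. Each passage `C_q V = V C_q +
C_(q+1)` creates the next iterated commutator, and the binomial coefficients follow from Pascal's
rule. -/
lemma derivative_pow_eq_sum (V : A[X]) (m : ℕ) :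
    derivative (V ^ m) =
      ∑ q ∈ range m, m.choose (q + 1) • (V ^ (m - 1 - q) * iterComm V q) := by
  induction m with
  | zero => simp
  | succ m ih =>
    have h1 : ∀ q ∈ range m, m.choose (q + 1) • (V ^ (m - 1 - q) * iterComm V q) * V =
        m.choose (q + 1) • (V ^ (m - q) * iterComm V q) +
          m.choose (q + 1) • (V ^ (m - 1 - q) * iterComm V (q + 1)) := by
      intro q hq
      have h : m - q = m - 1 - q + 1 := by have := mem_range.1 hq; omega
      rw [← smul_add, smul_mul_assoc, iterComm_succ, h, pow_succ]
      congr 1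
      noncomm_ring
    have h2 : ∀ q, m - 1 - q = m - (q + 1) := fun q => by omega
    have h3 : ∀ q, m + 1 - 1 - q = m - q := fun q => by omega
    rw [pow_succ, derivative_mul, ih, sum_mul, sum_congr rfl h1, sum_add_distrib]
    simp only [h2, h3, Nat.choose_succ_succ' m, add_smul, sum_add_distrib]
    have h4 := sum_range_succ' (fun q => m.choose q • (V ^ (m - q) * iterComm V q)) m
    have h5 := sum_range_succ (fun q => m.choose (q + 1) • (V ^ (m - q) * iterComm V q)) m
    rw [h5, h4]
    simp [iterComm]
    abel

lemma X_pow_mul_of_eq {V W : A[X]} {a b : ℕ} {V' W' : A[X]} (hV : V = X ^ a * V')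
    (hW : W = X ^ b * W') : V * W = X ^ (a + b) * (V' * W') := by
  rw [hV, hW, pow_add, mul_assoc, mul_assoc, ← mul_assoc V', ← (X_pow_mul (n := b) (p := V')),
    mul_assoc]

/-- Each commutator with `V` contributes a factor `X`, which makes the truncations below harmless in
low degree. -/
lemma iterComm_eq_X_pow_mul {V : A[X]} (hV : V.coeff 0 = 0) (q : ℕ) :
    ∃ W, iterComm V q = X ^ q * W := by
  obtain ⟨V', hV'⟩ := X_dvd_iff.2 hV
  induction q with
  | zero => exact ⟨_, (one_mul _).symm⟩
  | succ q ih =>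
    obtain ⟨W, hW⟩ := ih
    refine ⟨W * V' - V' * W, ?_⟩
    rw [iterComm_succ, X_pow_mul_of_eq hW (by rw [pow_one]; exact hV'),
      X_pow_mul_of_eq (a := 1) (by rw [pow_one]; exact hV') hW, add_comm 1 q, mul_sub]

lemma pow_eq_X_pow_mul {V : A[X]} (hV : V.coeff 0 = 0) (q : ℕ) :
    ∃ W, V ^ q = X ^ q * W := by
  obtain ⟨V', hV'⟩ := X_dvd_iff.2 hV
  refine ⟨V' ^ q, ?_⟩
  rw [hV', (commute_X V').mul_pow]

/-- The right-nested iterated commutator of the elements `x i`, `i ∈ l`. -/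
def nestedComm (x : ℕ → A) : List ℕ → A
  | [] => 0
  | [i] => x i
  | i :: j :: l => x i * nestedComm x (j :: l) - nestedComm x (j :: l) * x i

lemma nestedComm_cons (x : ℕ → A) (i : ℕ) {l : List ℕ} (hl : l ≠ []) :
    nestedComm x (i :: l) = x i * nestedComm x l - nestedComm x l * x i := by
  obtain ⟨j, l, rfl⟩ := List.exists_cons_of_ne_nil hl
  rfl

/-- The innermost commutator is antisymmetric, and the outer ones are linear in it. -/
lemma nestedComm_swap (x : ℕ → A) (l : List ℕ) (a b : ℕ) :
    nestedComm x (l ++ [b, a]) = -nestedComm x (l ++ [a, b]) := by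
  induction l with
  | nil => simp [nestedComm]
  | cons i l ih =>
    rw [List.cons_append, List.cons_append, nestedComm_cons x i (by simp),
      nestedComm_cons x i (by simp), ih]
    noncomm_ring

/-- Multilinear expansion: the last index comes from the factor `V'`, which supplies its weight and
lowers the degree by one; each `-ad V` supplies a sign and one more index in front. -/
lemma iterComm_eq_sum (x : ℕ → A) (N q : ℕ) :
    iterComm (∑ i ∈ Icc 1 N, monomial i (x i)) q =
      ∑ I ∈ Fintype.piFinset (fun _ : Fin (q + 1) => Icc 1 N),
        monomial (∑ l, I l - 1)
          (((-1) ^ q * (I (Fin.last q) : ℤ)) • nestedComm x (List.ofFn I)) := by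
  induction q with
  | zero =>
    rw [iterComm, Function.iterate_zero, id, derivative_sum]
    refine sum_bij' (fun i _ _ => i) (fun I _ => I 0) ?_ ?_ ?_ ?_ ?_
    · intro i hi; simpa [Fintype.mem_piFinset] using hi
    · intro I hI; exact Fintype.mem_piFinset.1 hI 0
    · intro i _; rfl
    · intro I _; ext l; fin_cases l; rfl
    · intro i _
      rw [derivative_monomial]
      simp [nestedComm, Nat.cast_comm]
  | succ q ih =>
    rw [iterComm_succ, ih, sum_mul_sum, sum_mul_sum, sum_comm, ← sum_sub_distrib]
    simp only [← sum_sub_distrib, monomial_mul_monomial]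
    rw [← sum_product']
    refine sum_bij' (fun p _ => Fin.cons p.1 p.2) (fun I _ => (I 0, Fin.tail I)) ?_ ?_ ?_ ?_ ?_
    · rintro ⟨i, I⟩ h
      simp only [mem_product, Fintype.mem_piFinset] at h ⊢
      intro l
      refine Fin.cases ?_ (fun l => ?_) l
      · exact h.1
      · exact h.2 l
    · intro I h
      simp only [mem_product, Fintype.mem_piFinset] at h ⊢
      exact ⟨h 0, fun l => h l.succ⟩
    · rintro ⟨i, I⟩ _; simp
    · intro I _; simp
    · rintro ⟨i, I⟩ h
      simp only [mem_product, Fintype.mem_piFinset, Finset.mem_Icc] at h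
      -- Positivity of the indices makes the truncated subtraction in the degree a true one.
      have h1 : 1 ≤ ∑ l, I l := (h.2 0).1.trans (single_le_sum (by simp) (mem_univ 0))
      have h2 : ∑ l, I l - 1 + i = i + ∑ l, I l - 1 := by omega
      have h3 : i + (∑ l, I l - 1) = i + ∑ l, I l - 1 := by omega
      simp only [Fin.sum_univ_succ (n := q + 1), Fin.cons_zero, Fin.cons_succ, h2, h3]
      rw [← map_sub, ← Fin.succ_last, Fin.cons_succ, List.ofFn_cons,
        nestedComm_cons x i (by simp), pow_succ, mul_neg_one, neg_mul, neg_smul, ← smul_neg,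
        neg_sub, smul_sub, smul_mul_assoc, mul_smul_comm]

variable [Algebra ℝ A]

/-- The exponential series truncated after the power `M`. -/
def expTrunc (M : ℕ) (V : A[X]) : A[X] := ∑ m ∈ range (M + 1), (m ! : ℝ)⁻¹ • V ^ m

/-- The truncated series `(1 - exp (-ad V)) / ad V` applied to `V'`. -/
def logDerivTrunc (M : ℕ) (V : A[X]) : A[X] :=
  ∑ q ∈ range M, ((q + 1)! : ℝ)⁻¹ • iterComm V q

/-- With `m = p + q + 1`, the factor `choose m (q+1) / m!` splits as `1 / (p! (q+1)!)`, so the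
double sum becomes a product. The extra terms of the product have `p + q ≥ M > j` and are divisible
by `X ^ (p + q)`. -/
theorem coeff_derivative_expTrunc {V : A[X]} (hV : V.coeff 0 = 0) {M j : ℕ} (hj : j < M) :
    (derivative (expTrunc M V)).coeff j = (expTrunc M V * logDerivTrunc M V).coeff j := by
  have hterm : ∀ p q, j < p + q → (V ^ p * iterComm V q).coeff j = 0 := by
    intro p q hpq
    obtain ⟨W, hW⟩ := pow_eq_X_pow_mul hV p
    obtain ⟨W', hW'⟩ := iterComm_eq_X_pow_mul hV q
    rw [X_pow_mul_of_eq hW hW', coeff_X_pow_mul', if_neg (by omega)]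
  have h1 : (derivative (expTrunc M V)).coeff j = ∑ m ∈ range (M + 1), ∑ q ∈ range m,
      ((m - 1 - q)! : ℝ)⁻¹ • ((q + 1)! : ℝ)⁻¹ • (V ^ (m - 1 - q) * iterComm V q).coeff j := by
    simp only [expTrunc, derivative_sum, derivative_smul, derivative_pow_eq_sum, finsetSum_coeff,
      coeff_smul, smul_sum]
    refine sum_congr rfl fun m _ => sum_congr rfl fun q hq => ?_
    have hq' : q + 1 ≤ m := mem_range.1 hq
    rw [← Nat.cast_smul_eq_nsmul ℝ, smul_smul, smul_smul, Nat.cast_choose ℝ hq']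
    congr 1
    have e : m - (q + 1) = m - 1 - q := by omega
    rw [e]
    have := Nat.cast_ne_zero (R := ℝ).2 (Nat.factorial_ne_zero m)
    field_simp
  have h2 : (expTrunc M V * logDerivTrunc M V).coeff j = ∑ p ∈ range (M + 1), ∑ q ∈ range M,
      (p ! : ℝ)⁻¹ • ((q + 1)! : ℝ)⁻¹ • (V ^ p * iterComm V q).coeff j := by
    simp only [expTrunc, logDerivTrunc, sum_mul_sum, finsetSum_coeff, smul_mul_smul_comm, mul_smul,
      coeff_smul]
  rw [h1, h2, sum_sigma', ← sum_product']
  refine sum_bij_ne_zero (fun a _ _ => (a.1 - 1 - a.2, a.2)) ?_ ?_ ?_ ?_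
  · rintro ⟨m, q⟩ h _
    simp only [mem_sigma, Finset.mem_range, mem_product] at h ⊢
    omega
  · rintro ⟨m, q⟩ h _ ⟨m', q'⟩ h' _ he
    simp only [mem_sigma, Finset.mem_range, Prod.mk.injEq] at h h' he
    obtain ⟨he1, rfl⟩ := he
    obtain rfl : m = m' := by omega
    rfl
  · rintro ⟨p, q⟩ h hne
    have hpq : p + q ≤ j := by
      by_contra hlt
      exact hne (by rw [hterm p q (by omega), smul_zero, smul_zero])
    have e : p + q + 1 - 1 - q = p := by omega
    refine ⟨⟨p + q + 1, q⟩, ?_, ?_, ?_⟩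
    · simp only [mem_sigma, Finset.mem_range]; omega
    · simpa only [e] using hne
    · simp only [e]
  · rintro ⟨m, q⟩ _ _
    rfl

/-- Exchanging the last two indices preserves their sum and negates the nested commutator. Pairing
each tuple with its exchange thus replaces the weight by a difference, and tuples whose last two
indices agree drop out. -/
lemma sum_last_smul_nestedComm (x : ℕ → A) (s : Finset ℕ) (k m : ℕ) :
    ∑ I ∈ Fintype.piFinset (fun _ : Fin (m + 2) => s),
      (if ∑ l, I l = k then (I (Fin.last (m + 1)) : ℝ) • nestedComm x (List.ofFn I) else 0) =
    ∑ I ∈ Fintype.piFinset (fun _ : Fin (m + 2) => s),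
      if ∑ l, I l = k ∧ I (Fin.last m).castSucc < I (Fin.last (m + 1)) then
        ((I (Fin.last (m + 1)) : ℝ) - I (Fin.last m).castSucc) • nestedComm x (List.ofFn I)
      else 0 := by
  let σ : Equiv.Perm (Fin (m + 2)) := Equiv.swap (Fin.last m).castSucc (Fin.last (m + 1))
  have hσσ : ∀ i, σ (σ i) = i := fun i => Equiv.swap_apply_self _ _ _
  have hσl : σ (Fin.last (m + 1)) = (Fin.last m).castSucc := Equiv.swap_apply_right _ _
  have hσp : σ (Fin.last m).castSucc = Fin.last (m + 1) := Equiv.swap_apply_left _ _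
  have hσ0 : ∀ i : Fin m, σ i.castSucc.castSucc = i.castSucc.castSucc := fun i =>
    Equiv.swap_apply_of_ne_of_ne
      (fun h => (Fin.castSucc_lt_last i).ne (Fin.castSucc_injective _ h))
      (Fin.castSucc_lt_last _).ne
  have hre : ∀ f : (Fin (m + 2) → ℕ) → A, ∑ I ∈ Fintype.piFinset (fun _ => s), f (I ∘ σ) =
      ∑ I ∈ Fintype.piFinset (fun _ => s), f I := by
    intro f
    refine sum_bij' (fun I _ => I ∘ σ) (fun I _ => I ∘ σ) ?_ ?_ ?_ ?_ (fun _ _ => rfl)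
    · intro I h; exact Fintype.mem_piFinset.2 fun l => Fintype.mem_piFinset.1 h (σ l)
    · intro I h; exact Fintype.mem_piFinset.2 fun l => Fintype.mem_piFinset.1 h (σ l)
    · intro I _; ext l; simp [hσσ]
    · intro I _; ext l; simp [hσσ]
  have hnc : ∀ I : Fin (m + 2) → ℕ,
      nestedComm x (List.ofFn (I ∘ σ)) = -nestedComm x (List.ofFn I) := by
    have hsplit : ∀ I : Fin (m + 2) → ℕ, List.ofFn I =
        List.ofFn (fun i : Fin m => I i.castSucc.castSucc) ++
          [I (Fin.last m).castSucc, I (Fin.last (m + 1))] := by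
      intro I
      rw [List.ofFn_succ', List.ofFn_succ']
      simp
    intro I
    rw [hsplit I, hsplit (I ∘ σ), ← nestedComm_swap]
    simp only [Function.comp_apply, hσl, hσp, hσ0]
  have hsum : ∀ I : Fin (m + 2) → ℕ, ∑ l, I (σ l) = ∑ l, I l := fun I => Equiv.sum_comp σ I
  -- Both sides are doubled, so that each sum can be added to its reindexing by the transposition
  -- and compared term by term.
  have h2 : ∀ a b : A, (2 : ℝ) • a = (2 : ℝ) • b → a = b := fun a b h =>
    (smul_right_injective A (two_ne_zero (α := ℝ))) h
  refine h2 _ _ ?_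
  rw [two_smul, two_smul]
  nth_rewrite 1 [← hre]
  nth_rewrite 3 [← hre]
  rw [← sum_add_distrib, ← sum_add_distrib]
  refine sum_congr rfl fun I _ => ?_
  simp only [hnc, Function.comp_apply, hσl, hσp, hsum]
  by_cases hk : ∑ l, I l = k
  · simp only [hk, true_and, if_true]
    rcases lt_trichotomy (I (Fin.last m).castSucc) (I (Fin.last (m + 1))) with h | h | h
    · rw [if_neg h.not_gt, if_pos h]; module
    · simp only [h, lt_irrefl, if_false, smul_neg, neg_add_cancel, add_zero]
    · rw [if_neg h.not_gt, if_pos h]; module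
  · simp [hk]

/-- The coefficients of the logarithmic derivative of `exp (∑ t ^ i x_i)`. -/
theorem coeff_logDerivTrunc (x : ℕ → A) {N k : ℕ} (hk : 1 ≤ k) (hkN : k ≤ N) :
    (logDerivTrunc N (∑ i ∈ Icc 1 N, monomial i (x i))).coeff (k - 1) =
      (k : ℝ) • (x k + ∑ m ∈ range (k - 2), ∑ I ∈ Fintype.piFinset
        (fun _ : Fin (m + 2) => Icc 1 k), (bracketCoeff k I : ℝ) • nestedComm x (List.ofFn I)) := by
  obtain ⟨M, rfl⟩ : ∃ M, N = M + 1 := ⟨N - 1, by omega⟩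
  have hk0 : (k : ℝ) ≠ 0 := Nat.cast_ne_zero.2 (by omega)
  rw [logDerivTrunc, sum_range_succ', add_comm, coeff_add, smul_add]
  congr 1
  · rw [zero_add, Nat.factorial_one, Nat.cast_one, inv_one, one_smul, iterComm,
      Function.iterate_zero, id, derivative_sum, finsetSum_coeff,
      sum_eq_single_of_mem k (by simp [hk, hkN])]
    · rw [derivative_monomial, coeff_monomial_same, ← nsmul_eq_mul',
        Nat.cast_smul_eq_nsmul]
    · intro i hi hik
      have := (Finset.mem_Icc.1 hi).1
      rw [derivative_monomial, coeff_monomial, if_neg (by omega)]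
  have hterm : ∀ m, (((m + 1 + 1)! : ℝ)⁻¹ •
      iterComm (∑ i ∈ Icc 1 (M + 1), monomial i (x i)) (m + 1)).coeff (k - 1) =
      (k : ℝ) • ∑ I ∈ Fintype.piFinset (fun _ : Fin (m + 2) => Icc 1 k),
        (bracketCoeff k I : ℝ) • nestedComm x (List.ofFn I) := by
    intro m
    have h1 : (iterComm (∑ i ∈ Icc 1 (M + 1), monomial i (x i)) (m + 1)).coeff (k - 1) =
        (-1 : ℝ) ^ (m + 1) • ∑ I ∈ Fintype.piFinset (fun _ : Fin (m + 2) => Icc 1 (M + 1)),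
        (if ∑ l, I l = k then (I (Fin.last (m + 1)) : ℝ) • nestedComm x (List.ofFn I) else 0) := by
      rw [iterComm_eq_sum, finsetSum_coeff, smul_sum]
      refine sum_congr rfl fun I hI => ?_
      have h1 : 1 ≤ ∑ l, I l :=
        (Finset.mem_Icc.1 (Fintype.mem_piFinset.1 hI 0)).1.trans (single_le_sum (by simp)
          (mem_univ 0))
      rw [coeff_monomial]
      by_cases h : ∑ l, I l = k
      · rw [if_pos (by omega), if_pos h, smul_smul, ← Int.cast_smul_eq_zsmul ℝ]
        push_cast
        rfl
      · rw [if_neg (by omega), if_neg h, smul_zero]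
    rw [coeff_smul, h1, sum_last_smul_nestedComm, smul_smul, smul_sum, smul_sum]
    symm
    refine sum_subset_zero_on_sdiff ?_ ?_ ?_
    · intro I hI
      simp only [Fintype.mem_piFinset, Finset.mem_Icc] at hI ⊢
      exact fun l => ⟨(hI l).1, (hI l).2.trans hkN⟩
    · intro I hI
      rw [if_neg, smul_zero]
      rintro ⟨h, -⟩
      refine (mem_sdiff.1 hI).2 ?_
      have hI' := (mem_sdiff.1 hI).1
      simp only [Fintype.mem_piFinset, Finset.mem_Icc] at hI' ⊢
      exact fun l => ⟨(hI' l).1, h ▸ single_le_sum (fun _ _ => Nat.zero_le _) (mem_univ l)⟩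
    · intro I _
      rw [bracketCoeff]
      split_ifs with h
      -- The value of the signed sum matches `(-1)^(m+1) / (m+2)!`, the coefficient in the series
      -- for `L`.
      · rw [smul_smul, smul_smul, chSignedSum_eq]
        congr 1
        push_cast
        field_simp
        ring
      · simp
  rw [finsetSum_coeff, sum_congr rfl fun m _ => hterm m, smul_sum]
  symm
  -- Here `m + 2` positive indices with a strict increase at the end sum to at least `m + 3`, which
  -- exceeds `k` once `m ≥ k - 2`.
  refine sum_subset (range_mono (by omega)) fun m _ hm => ?_
  rw [sum_eq_zero, smul_zero]
  intro I hI
  rw [bracketCoeff, if_neg, Rat.cast_zero, zero_smul]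
  rintro ⟨h1, h2⟩
  simp only [Fintype.mem_piFinset, Finset.mem_Icc, Finset.mem_range] at hI hm
  rw [Fin.sum_univ_castSucc] at h1
  have h3 : ∑ l : Fin (m + 1), 1 ≤ ∑ l : Fin (m + 1), I l.castSucc :=
    sum_le_sum fun l _ => (hI _).1
  have h4 := (hI (Fin.last m).castSucc).1
  simp at h3
  omega

end NoncommutativeAlgebra

/-! ### Vector fields as operators on smooth functions -/

section SmoothFunctions

variable {E : Type*} [NormedAddCommGroup E] [NormedSpace ℝ E] {Ω : Set E}

/-- The maps that are smooth on `Ω` and vanish outside `Ω`. -/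
def SmoothOn (Ω : Set E) : Submodule ℝ (E → E) where
  carrier := {f | ContDiffOn ℝ ∞ f Ω ∧ ∀ x ∉ Ω, f x = 0}
  add_mem' hf hg := ⟨hf.1.add hg.1, fun x hx => by simp [hf.2 x hx, hg.2 x hx]⟩
  zero_mem' := ⟨contDiffOn_const, fun _ _ => rfl⟩
  smul_mem' c f hf := ⟨hf.1.const_smul c, fun x hx => by simp [hf.2 x hx]⟩

/-- The restriction to `Ω` of a map that is smooth on `Ω`. -/
def SmoothOn.mk (f : E → E) (hf : ContDiffOn ℝ ∞ f Ω) : SmoothOn Ω :=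
  ⟨Ω.indicator f, hf.congr fun _ hx => indicator_of_mem hx f,
    fun _ hx => indicator_of_notMem hx f⟩

lemma SmoothOn.mk_apply {f : E → E} (hf : ContDiffOn ℝ ∞ f Ω) {x : E} (hx : x ∈ Ω) :
    (SmoothOn.mk f hf).1 x = f x := indicator_of_mem hx f

/-- Vanishing off `Ω` removes the ambiguity outside the domain, so identities checked on `Ω` become
equalities in the endomorphism ring of a genuine module. -/
lemma SmoothOn.ext_on {f g : SmoothOn Ω} (h : EqOn f.1 g.1 Ω) : f = g := by
  refine Subtype.ext (funext fun x => ?_)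
  by_cases hx : x ∈ Ω
  · exact h hx
  · rw [f.2.2 x hx, g.2.2 x hx]

lemma contDiffAt_of_contDiffOn_isOpen {F G : Type*} [NormedAddCommGroup F] [NormedSpace ℝ F]
    [NormedAddCommGroup G] [NormedSpace ℝ G] {U : Set F} (hU : IsOpen U) {f : F → G}
    (hf : ContDiffOn ℝ ∞ f U) {x : F} (hx : x ∈ U) : ContDiffAt ℝ ∞ f x :=
  hf.contDiffAt (hU.mem_nhds hx)

lemma contDiffOn_fderiv_apply {F G : Type*} [NormedAddCommGroup F] [NormedSpace ℝ F]
    [NormedAddCommGroup G] [NormedSpace ℝ G] {U : Set F} (hU : IsOpen U) {f : F → G} {V : F → F}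
    (hf : ContDiffOn ℝ ∞ f U) (hV : ContDiffOn ℝ ∞ V U) :
    ContDiffOn ℝ ∞ (fun x => fderiv ℝ f x (V x)) U :=
  (hf.fderiv_of_isOpen hU (m := ∞) (by simp)).clm_apply hV

variable [hΩ : Fact (IsOpen Ω)]

/-- The derivation by a smooth vector field, as an operator on smooth functions. -/
def vfOp : SmoothOn Ω →ₗ[ℝ] Module.End ℝ (SmoothOn Ω) :=
  LinearMap.mk₂ ℝ (fun V f => SmoothOn.mk (fun x => fderiv ℝ f.1 x (V.1 x))
      (contDiffOn_fderiv_apply hΩ.out f.2.1 V.2.1))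
    (fun V W f => SmoothOn.ext_on fun x hx => by
      simp [SmoothOn.mk_apply _ hx])
    (fun c V f => SmoothOn.ext_on fun x hx => by
      simp [SmoothOn.mk_apply _ hx])
    (fun V f g => SmoothOn.ext_on fun x hx => by
      have hf := (contDiffAt_of_contDiffOn_isOpen hΩ.out f.2.1 hx).differentiableAt (by simp)
      have hg := (contDiffAt_of_contDiffOn_isOpen hΩ.out g.2.1 hx).differentiableAt (by simp)
      simp [SmoothOn.mk_apply _ hx, fderiv_add hf hg])
    (fun c V f => SmoothOn.ext_on fun x hx => by
      have hf := (contDiffAt_of_contDiffOn_isOpen hΩ.out f.2.1 hx).differentiableAt (by simp)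
      simp [SmoothOn.mk_apply _ hx, fderiv_const_smul hf])

lemma vfOp_apply (V f : SmoothOn Ω) {x : E} (hx : x ∈ Ω) :
    (vfOp V f).1 x = fderiv ℝ f.1 x (V.1 x) :=
  SmoothOn.mk_apply (contDiffOn_fderiv_apply hΩ.out f.2.1 V.2.1) hx

variable (Ω) in
/-- The identity map as a smooth map on `Ω`. -/
def idOn : SmoothOn Ω := SmoothOn.mk id contDiffOn_id

omit hΩ in
lemma idOn_apply {x : E} (hx : x ∈ Ω) : (idOn Ω).1 x = x := SmoothOn.mk_apply _ hx

/-- A field is recovered from its derivation by differentiating the coordinate functions. -/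
lemma vfOp_idOn (V : SmoothOn Ω) : vfOp V (idOn Ω) = V := by
  refine SmoothOn.ext_on fun x hx => ?_
  have h : (idOn Ω).1 =ᶠ[𝓝 x] id := by
    filter_upwards [hΩ.out.mem_nhds hx] with y hy using idOn_apply hy
  rw [vfOp_apply _ _ hx, h.fderiv_eq, fderiv_id]
  rfl

/-- The second-order parts cancel by symmetry of the second derivative. -/
lemma vfOp_commutator (V W : SmoothOn Ω) :
    ∃ B : SmoothOn Ω, EqOn B.1 (VectorField.lieBracket ℝ V.1 W.1) Ω ∧
      vfOp V * vfOp W - vfOp W * vfOp V = vfOp B := by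
  have hB : ContDiffOn ℝ ∞ (VectorField.lieBracket ℝ V.1 W.1) Ω :=
    (contDiffOn_fderiv_apply hΩ.out W.2.1 V.2.1).sub
      (contDiffOn_fderiv_apply hΩ.out V.2.1 W.2.1)
  refine ⟨SmoothOn.mk _ hB, fun x hx => SmoothOn.mk_apply _ hx, ?_⟩
  refine LinearMap.ext fun f => SmoothOn.ext_on fun x hx => ?_
  have hV := contDiffAt_of_contDiffOn_isOpen hΩ.out V.2.1 hx
  have hW := contDiffAt_of_contDiffOn_isOpen hΩ.out W.2.1 hx
  have hf := contDiffAt_of_contDiffOn_isOpen hΩ.out f.2.1 hx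
  have h1 : ∀ Y : SmoothOn Ω, (vfOp Y f).1 =ᶠ[𝓝 x] fun z => fderiv ℝ f.1 z (Y.1 z) := by
    intro Y
    filter_upwards [hΩ.out.mem_nhds hx] with y hy using vfOp_apply _ _ hy
  change (vfOp V (vfOp W f)).1 x - (vfOp W (vfOp V f)).1 x = _
  rw [vfOp_apply _ _ hx, vfOp_apply _ _ hx, vfOp_apply _ _ hx, SmoothOn.mk_apply _ hx,
    (h1 V).fderiv_eq, (h1 W).fderiv_eq, VectorField.fderiv_apply_lieBracket hf (by
      rw [minSmoothness_of_isRCLikeNormedField]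
      exact WithTop.coe_le_coe.2 (le_top : (2 : ℕ∞) ≤ ⊤))
    (hW.differentiableAt (by simp)) (hV.differentiableAt (by simp))]

lemma nestedComm_vfOp {n : ℕ} {Ω : Set (EuclideanSpace ℝ (Fin n))} [hΩ : Fact (IsOpen Ω)]
    (X : ℕ → EuclideanSpace ℝ (Fin n) → EuclideanSpace ℝ (Fin n)) (Y : ℕ → SmoothOn Ω)
    (l : List ℕ) (hl : ∀ i ∈ l, EqOn (Y i).1 (X i) Ω) :
    ∃ B : SmoothOn Ω, EqOn B.1 (nestedBracket X l) Ω ∧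
      nestedComm (fun i => vfOp (Y i)) l = vfOp B := by
  induction l with
  | nil => exact ⟨0, fun x _ => rfl, (map_zero _).symm⟩
  | cons i l ih =>
    rcases l with _ | ⟨j, l⟩
    · exact ⟨Y i, hl i (by simp), rfl⟩
    · obtain ⟨B, hB, hB'⟩ := ih fun k hk => hl k (List.mem_cons_of_mem _ hk)
      obtain ⟨C, hC, hC'⟩ := vfOp_commutator (Y i) B
      refine ⟨C, fun x hx => ?_, ?_⟩
      · rw [hC hx]
        exact Filter.EventuallyEq.lieBracket_vectorField_eq
          ((hl i (by simp)).eventuallyEq_of_mem (hΩ.out.mem_nhds hx))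
          (hB.eventuallyEq_of_mem (hΩ.out.mem_nhds hx))
      · rw [← hC', ← hB']
        rfl

/-- The coefficients of the logarithmic derivative are the modified vector fields. -/
lemma coeff_logDerivTrunc_vfOp {n : ℕ} {Ω : Set (EuclideanSpace ℝ (Fin n))}
    [hΩ : Fact (IsOpen Ω)] (X : ℕ → EuclideanSpace ℝ (Fin n) → EuclideanSpace ℝ (Fin n))
    (Y : ℕ → SmoothOn Ω) {N : ℕ} (hY : ∀ i ∈ Finset.Icc 1 N, EqOn (Y i).1 (X i) Ω) {k : ℕ}
    (hk : 1 ≤ k) (hkN : k ≤ N) :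
    EqOn ((logDerivTrunc N (∑ i ∈ Finset.Icc 1 N, Polynomial.monomial i (vfOp (Y i)))).coeff (k - 1)
      (idOn Ω)).1 (fun x => (k : ℝ) • hatField X k x) Ω := by
  have h : ∀ (m : ℕ) (I : Fin (m + 2) → ℕ), ∃ B : SmoothOn Ω,
      I ∈ Fintype.piFinset (fun _ : Fin (m + 2) => Finset.Icc 1 k) →
      EqOn B.1 (nestedBracket X (List.ofFn I)) Ω ∧
      nestedComm (fun i => vfOp (Y i)) (List.ofFn I) = vfOp B := by
    intro m I
    by_cases hI : I ∈ Fintype.piFinset (fun _ : Fin (m + 2) => Finset.Icc 1 k)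
    · obtain ⟨B, hB⟩ := nestedComm_vfOp X Y (List.ofFn I) (by
        intro i hi
        obtain ⟨l, rfl⟩ := (List.mem_ofFn' I i).1 hi
        have := Finset.mem_Icc.1 (Fintype.mem_piFinset.1 hI l)
        exact hY _ (Finset.mem_Icc.2 ⟨this.1, this.2.trans hkN⟩))
      exact ⟨B, fun _ => hB⟩
    · exact ⟨0, fun h => absurd h hI⟩
  choose B hB using h
  have h2 : (logDerivTrunc N (∑ i ∈ Finset.Icc 1 N, Polynomial.monomial i (vfOp (Y i)))).coeff
      (k - 1) = vfOp ((k : ℝ) • (Y k + ∑ m ∈ Finset.range (k - 2), ∑ I ∈ Fintype.piFinset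
        (fun _ : Fin (m + 2) => Finset.Icc 1 k), (bracketCoeff k I : ℝ) • B m I)) := by
    rw [coeff_logDerivTrunc (fun i => vfOp (Y i)) hk hkN]
    simp only [map_smul, map_add, map_sum]
    congr 2
    refine Finset.sum_congr rfl fun m _ => Finset.sum_congr rfl fun I hI => ?_
    rw [(hB m I hI).2]
  intro x hx
  rw [h2, vfOp_idOn]
  simp only [Submodule.coe_smul, Submodule.coe_add, Submodule.coe_sum, Pi.smul_apply, Pi.add_apply,
    Finset.sum_apply, hatField]
  rw [hY k (Finset.mem_Icc.2 ⟨hk, hkN⟩) hx]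
  congr 2
  refine Finset.sum_congr rfl fun m _ => Finset.sum_congr rfl fun I hI => ?_
  rw [(hB m I hI).1 hx]

/-- Evaluation at a real number of a polynomial with operator coefficients. -/
def evalOp {S : Type*} [AddCommGroup S] [Module ℝ S] (t : ℝ) :
    Polynomial (Module.End ℝ S) →+* Module.End ℝ S :=
  Polynomial.eval₂RingHom' (RingHom.id _) (algebraMap ℝ _ t) fun a =>
    (Algebra.commutes t a).symm

lemma evalOp_apply_eq_sum {S : Type*} [AddCommGroup S] [Module ℝ S] (t : ℝ)
    (P : Polynomial (Module.End ℝ S)) (f : S) {D : ℕ} (hD : P.natDegree < D) :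
    evalOp t P f = ∑ k ∈ Finset.range D, t ^ k • P.coeff k f := by
  change P.eval (algebraMap ℝ _ t) f = _
  rw [Polynomial.eval_eq_sum_range' hD, LinearMap.sum_apply]
  refine Finset.sum_congr rfl fun k _ => ?_
  rw [← map_pow, ← Algebra.commutes, ← Algebra.smul_def, LinearMap.smul_apply]

lemma evalOp_smul {S : Type*} [AddCommGroup S] [Module ℝ S] (t c : ℝ)
    (P : Polynomial (Module.End ℝ S)) : evalOp t (c • P) = c • evalOp t P := by
  refine LinearMap.ext fun f => ?_
  rw [evalOp_apply_eq_sum t _ f ((Polynomial.natDegree_smul_le c P).trans_lt (Nat.lt_succ_self _)),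
    LinearMap.smul_apply, evalOp_apply_eq_sum t P f (Nat.lt_succ_self _), Finset.smul_sum]
  refine Finset.sum_congr rfl fun k _ => ?_
  rw [Polynomial.coeff_smul, LinearMap.smul_apply, smul_comm]

lemma evalOp_monomial {S : Type*} [AddCommGroup S] [Module ℝ S] (t : ℝ) (i : ℕ)
    (a : Module.End ℝ S) : evalOp t (Polynomial.monomial i a) = t ^ i • a := by
  change (Polynomial.monomial i a).eval (algebraMap ℝ _ t) = _
  rw [Polynomial.eval_monomial, ← map_pow, ← Algebra.commutes, ← Algebra.smul_def]

lemma evalOp_X_pow {S : Type*} [AddCommGroup S] [Module ℝ S] (t : ℝ) (i : ℕ) :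
    evalOp (S := S) t (Polynomial.X ^ i) = t ^ i • 1 := by
  rw [← Polynomial.monomial_one_right_eq_X_pow, evalOp_monomial]

end SmoothFunctions

/-! ### Asymptotic expansions -/

section Expansions

open Asymptotics

variable {E : Type*} [NormedAddCommGroup E] [NormedSpace ℝ E]

/-- `g t = ∑_{k < K} t ^ k a_k + O(t ^ K)` as `t → 0`. -/
def HasExpansion (K : ℕ) (g : ℝ → E) (a : ℕ → E) : Prop :=
  (fun t => g t - ∑ k ∈ Finset.range K, t ^ k • a k) =O[𝓝 0] fun t => t ^ K

lemma isBigO_pow_of_le {K L : ℕ} (h : K ≤ L) : (fun t : ℝ => t ^ L) =O[𝓝 0] fun t => t ^ K := by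
  obtain ⟨d, rfl⟩ := Nat.exists_eq_add_of_le h
  have h1 : (fun t : ℝ => t ^ d) =O[𝓝 0] fun _ => (1 : ℝ) :=
    ((continuous_pow d).tendsto (0 : ℝ)).isBigO_one ℝ
  simpa [pow_add] using (isBigO_refl (fun t : ℝ => t ^ K) (𝓝 0)).mul h1

lemma isBigO_pow_smul_const {K L : ℕ} (h : K ≤ L) (a : E) :
    (fun t : ℝ => t ^ L • a) =O[𝓝 0] fun t => t ^ K := by
  have h1 := (isBigO_pow_of_le h).smul (isBigO_refl (fun _ : ℝ => a) (𝓝 0))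
  refine h1.trans ?_
  simpa using (isBigO_refl (fun t : ℝ => t ^ K) (𝓝 0)).smul
    (isBigO_const_const a (one_ne_zero (α := ℝ)) (𝓝 0))

lemma HasExpansion.of_le {K L : ℕ} {g : ℝ → E} {a : ℕ → E} (h : HasExpansion L g a)
    (hKL : K ≤ L) : HasExpansion K g a := by
  obtain ⟨d, rfl⟩ := Nat.exists_eq_add_of_le hKL
  have h1 : (fun t : ℝ => ∑ k ∈ Finset.range d, t ^ (K + k) • a (K + k)) =O[𝓝 0]
      fun t => t ^ K :=
    IsBigO.fun_sum fun k _ => isBigO_pow_smul_const (Nat.le_add_right K k) _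
  refine ((IsBigO.trans h (isBigO_pow_of_le hKL)).add h1).congr_left fun t => ?_
  rw [Finset.sum_range_add]
  abel

lemma HasExpansion.congr' {K : ℕ} {g g' : ℝ → E} {a : ℕ → E} (h : HasExpansion K g a)
    (hg : g =ᶠ[𝓝 0] g') : HasExpansion K g' a :=
  IsBigO.congr' h (hg.mono fun t ht => by simp only [ht]) EventuallyEq.rfl

lemma HasExpansion.add {K : ℕ} {g h : ℝ → E} {a b : ℕ → E} (hg : HasExpansion K g a)
    (hh : HasExpansion K h b) : HasExpansion K (g + h) (a + b) := by
  refine (IsBigO.add hg hh).congr_left fun t => ?_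
  simp only [Pi.add_apply, smul_add, Finset.sum_add_distrib]
  abel

lemma HasExpansion.zero (K : ℕ) : HasExpansion K (0 : ℝ → E) 0 := by
  simpa [HasExpansion] using isBigO_zero _ _

lemma HasExpansion.sum {ι : Type*} {K : ℕ} (s : Finset ι) {g : ι → ℝ → E} {a : ι → ℕ → E}
    (h : ∀ i ∈ s, HasExpansion K (g i) (a i)) :
    HasExpansion K (∑ i ∈ s, g i) (∑ i ∈ s, a i) := by
  classical
  induction s using Finset.induction_on with
  | empty => simpa using HasExpansion.zero K
  | insert i s hi ih =>
    rw [Finset.sum_insert hi, Finset.sum_insert hi]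
    exact (h i (by simp)).add (ih fun j hj => h j (by simp [hj]))

lemma HasExpansion.add_isBigO {K : ℕ} {g r : ℝ → E} {a : ℕ → E} (hg : HasExpansion K g a)
    (hr : r =O[𝓝 0] fun t => t ^ K) : HasExpansion K (fun t => g t + r t) a :=
  (IsBigO.add hg hr).congr_left fun t => by dsimp only; abel

lemma HasExpansion.pow_smul {K : ℕ} {g : ℝ → E} {a : ℕ → E} (hg : HasExpansion K g a) (j : ℕ) :
    HasExpansion K (fun t => t ^ j • g t) (fun k => if j ≤ k then a (k - j) else 0) := by
  have h1 : HasExpansion (j + K) (fun t => t ^ j • g t)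
      (fun k => if j ≤ k then a (k - j) else 0) := by
    have h2 := (isBigO_refl (fun t : ℝ => t ^ j) (𝓝 0)).smul hg
    refine (h2.congr_left fun t => ?_).congr_right fun t => ?_
    · have h0 : ∑ k ∈ Finset.range j, t ^ k • (if j ≤ k then a (k - j) else 0) = 0 :=
        Finset.sum_eq_zero fun k hk => by
          rw [if_neg (not_le.2 (Finset.mem_range.1 hk)), smul_zero]
      rw [Finset.sum_range_add, h0, zero_add, smul_sub, Finset.smul_sum]
      congr 1
      refine Finset.sum_congr rfl fun k _ => ?_
      dsimp only
      rw [if_pos (Nat.le_add_right j k), Nat.add_sub_cancel_left, pow_add, mul_smul]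
    · rw [smul_eq_mul, pow_add]
  exact h1.of_le (Nat.le_add_left K j)

lemma hasExpansion_polynomial (K D : ℕ) (a : ℕ → E) (ha : ∀ k, D ≤ k → a k = 0) :
    HasExpansion K (fun t => ∑ k ∈ Finset.range D, t ^ k • a k) a := by
  have h1 : HasExpansion (D + K) (fun t => ∑ k ∈ Finset.range D, t ^ k • a k) a := by
    refine (isBigO_zero (fun t : ℝ => t ^ (D + K)) (𝓝 0)).congr_left fun t => ?_
    rw [Finset.sum_range_add, eq_comm, sub_eq_zero, left_eq_add]
    exact Finset.sum_eq_zero fun k _ => by rw [ha _ (Nat.le_add_right D k), smul_zero]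
  exact h1.of_le (Nat.le_add_left K D)

lemma HasExpansion.unique {K : ℕ} {g : ℝ → E} {a b : ℕ → E} (ha : HasExpansion K g a)
    (hb : HasExpansion K g b) {k : ℕ} (hk : k < K) : a k = b k := by
  induction k using Nat.strong_induction_on with
  | _ k ih =>
  have ha' := ha.of_le (Nat.succ_le_of_lt hk)
  have hb' := hb.of_le (Nat.succ_le_of_lt hk)
  have h : (fun t : ℝ => t ^ k • (b k - a k)) =O[𝓝 0] fun t => t ^ (k + 1) := by
    refine (IsBigO.sub ha' hb').congr_left fun t => ?_
    rw [Finset.sum_range_succ, Finset.sum_range_succ, Finset.sum_congr rfl fun j hj => by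
      rw [ih j (Finset.mem_range.1 hj) ((Finset.mem_range.1 hj).trans hk)], smul_sub]
    abel
  obtain ⟨C, hC⟩ := h.bound
  have h2 : ∀ᶠ t : ℝ in 𝓝[≠] 0, ‖b k - a k‖ ≤ C * ‖t‖ := by
    filter_upwards [hC.filter_mono nhdsWithin_le_nhds, self_mem_nhdsWithin] with t ht ht0
    have ht0' : 0 < ‖t‖ ^ k := pow_pos (norm_pos_iff.2 ht0) k
    rw [norm_smul, norm_pow, norm_pow, pow_succ] at ht
    nlinarith
  have h3 : Tendsto (fun t : ℝ => C * ‖t‖) (𝓝[≠] 0) (𝓝 0) := by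
    have : Tendsto (fun t : ℝ => C * ‖t‖) (𝓝 0) (𝓝 (C * ‖(0 : ℝ)‖)) :=
      (continuous_const.mul continuous_norm).tendsto 0
    rw [norm_zero, mul_zero] at this
    exact this.mono_left nhdsWithin_le_nhds
  have h4 : ‖b k - a k‖ ≤ 0 := ge_of_tendsto h3 h2
  exact (sub_eq_zero.1 (norm_le_zero_iff.1 h4)).symm

/-! ### Taylor expansion in the time variable -/

variable {F : Type*} [NormedAddCommGroup F] [NormedSpace ℝ F]

/-- The partial derivative in the time variable. -/
def timeDeriv (f : ℝ × E → F) (p : ℝ × E) : F := fderiv ℝ f p (1, 0)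

lemma contDiffOn_timeDeriv {U : Set (ℝ × E)} (hU : IsOpen U) {f : ℝ × E → F}
    (hf : ContDiffOn ℝ ∞ f U) : ContDiffOn ℝ ∞ (timeDeriv f) U :=
  contDiffOn_fderiv_apply hU hf contDiffOn_const

lemma contDiffOn_timeDeriv_iterate {U : Set (ℝ × E)} (hU : IsOpen U) {f : ℝ × E → F}
    (hf : ContDiffOn ℝ ∞ f U) (j : ℕ) : ContDiffOn ℝ ∞ (timeDeriv^[j] f) U := by
  induction j generalizing f with
  | zero => exact hf
  | succ j ih => exact ih (contDiffOn_timeDeriv hU hf)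

lemma hasDerivAt_timeDeriv {U : Set (ℝ × E)} (hU : IsOpen U) {f : ℝ × E → F}
    (hf : ContDiffOn ℝ ∞ f U) {t : ℝ} {x : E} (h : (t, x) ∈ U) :
    HasDerivAt (fun s => f (s, x)) (timeDeriv f (t, x)) t := by
  have h1 := ((contDiffAt_of_contDiffOn_isOpen hU hf h).differentiableAt (by simp)).hasFDerivAt
  exact h1.comp_hasDerivAt t ((hasDerivAt_id t).prodMk (hasDerivAt_const t x))

lemma iteratedDeriv_eq_timeDeriv {U : Set (ℝ × E)} (hU : IsOpen U) {f : ℝ × E → F}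
    (hf : ContDiffOn ℝ ∞ f U) (j : ℕ) {t : ℝ} {x : E} (h : (t, x) ∈ U) :
    iteratedDeriv j (fun s => f (s, x)) t = timeDeriv^[j] f (t, x) := by
  induction j generalizing t with
  | zero => rw [iteratedDeriv_zero]; rfl
  | succ j ih =>
    have hev : iteratedDeriv j (fun s => f (s, x)) =ᶠ[𝓝 t] fun s => timeDeriv^[j] f (s, x) := by
      have : ∀ᶠ s in 𝓝 t, (s, x) ∈ U :=
        (Continuous.prodMk_left x).continuousAt.eventually_mem (hU.mem_nhds h)
      filter_upwards [this] with s hs using ih hs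
    rw [iteratedDeriv_succ, hev.deriv_eq, Function.iterate_succ_apply']
    exact (hasDerivAt_timeDeriv hU (contDiffOn_timeDeriv_iterate hU hf j) h).deriv

/-- Taylor's formula in the time variable, locally uniformly in the space variable. -/
lemma exists_norm_sub_taylor_le {U : Set (ℝ × E)} (hU : IsOpen U) {f : ℝ × E → F}
    (hf : ContDiffOn ℝ ∞ f U) {x : E} (h : ((0 : ℝ), x) ∈ U) (K : ℕ) :
    ∃ C, ∃ δ > 0, ∀ t : ℝ, |t| < δ → ∀ z ∈ Metric.ball x δ,
      ‖f (t, z) - ∑ j ∈ Finset.range K, t ^ j • ((j ! : ℝ)⁻¹ • timeDeriv^[j] f (0, z))‖ ≤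
        C * |t| ^ K := by
  induction K generalizing f with
  | zero =>
    have hc : ContinuousAt (fun p => ‖f p‖) ((0 : ℝ), x) :=
      (contDiffAt_of_contDiffOn_isOpen hU hf h).continuousAt.norm
    have h1 : ∀ᶠ p in 𝓝 ((0 : ℝ), x), ‖f p‖ < ‖f (0, x)‖ + 1 :=
      hc.eventually_lt continuousAt_const (lt_add_one _)
    obtain ⟨δ, hδ, h2⟩ := Metric.eventually_nhds_iff_ball.1 h1
    refine ⟨‖f (0, x)‖ + 1, δ, hδ, fun t ht z hz => ?_⟩
    have h3 : (t, z) ∈ Metric.ball ((0 : ℝ), x) δ := by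
      rw [← ball_prod_same]
      exact ⟨by simpa using ht, hz⟩
    simpa using (h2 _ h3).le
  | succ K ih =>
    obtain ⟨C, δ₁, hδ₁, hC⟩ := ih (contDiffOn_timeDeriv hU hf)
    obtain ⟨δ₂, hδ₂, hδU⟩ := Metric.isOpen_iff.1 hU _ h
    refine ⟨C, min δ₁ δ₂, lt_min hδ₁ hδ₂, fun t ht z hz => ?_⟩
    have hz1 : z ∈ Metric.ball x δ₁ := Metric.ball_subset_ball (min_le_left _ _) hz
    have hs : ∀ s ∈ uIcc 0 t, |s| ≤ |t| := fun s hs => by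
      simpa using abs_sub_left_of_mem_uIcc hs
    have hmem : ∀ s ∈ uIcc 0 t, (s, z) ∈ U := by
      intro s hst
      refine hδU ?_
      rw [← ball_prod_same]
      refine ⟨?_, Metric.ball_subset_ball (min_le_right _ _) hz⟩
      simpa using ((hs s hst).trans_lt ht).trans_le (min_le_right _ _)
    have hC0 : 0 ≤ C * |t| ^ K := (norm_nonneg _).trans (hC t (ht.trans_le (min_le_left _ _)) z hz1)
    let g : ℝ → F := fun s => f (s, z) -
      ∑ j ∈ Finset.range (K + 1), s ^ j • ((j ! : ℝ)⁻¹ • timeDeriv^[j] f (0, z))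
    -- The derivative of the remainder of order `K + 1` is the remainder of order `K` of the time
    -- derivative.
    have hg : ∀ s ∈ uIcc 0 t, HasDerivWithinAt g (timeDeriv f (s, z) -
        ∑ j ∈ Finset.range K, s ^ j • ((j ! : ℝ)⁻¹ • timeDeriv^[j] (timeDeriv f) (0, z)))
        (uIcc 0 t) s := by
      intro s hst
      refine ((hasDerivAt_timeDeriv hU hf (hmem s hst)).sub ?_).hasDerivWithinAt
      have h1 : HasDerivAt (fun s : ℝ => ∑ j ∈ Finset.range (K + 1), s ^ j •
          ((j ! : ℝ)⁻¹ • timeDeriv^[j] f (0, z))) (∑ j ∈ Finset.range (K + 1),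
          (j * s ^ (j - 1) : ℝ) • ((j ! : ℝ)⁻¹ • timeDeriv^[j] f (0, z))) s :=
        HasDerivAt.fun_sum fun j _ => (hasDerivAt_pow j s).smul_const _
      convert h1 using 1
      rw [Finset.sum_range_succ']
      simp only [Nat.cast_zero, zero_mul, zero_smul, add_zero]
      refine Finset.sum_congr rfl fun j _ => ?_
      rw [Function.iterate_succ_apply, smul_smul, smul_smul, Nat.factorial_succ,
        Nat.add_sub_cancel]
      congr 1
      push_cast
      field_simp
    have hbound : ∀ s ∈ uIcc 0 t, ‖timeDeriv f (s, z) - ∑ j ∈ Finset.range K,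
        s ^ j • ((j ! : ℝ)⁻¹ • timeDeriv^[j] (timeDeriv f) (0, z))‖ ≤ C * |t| ^ K := by
      intro s hst
      have h1 := hC s (((hs s hst).trans_lt ht).trans_le (min_le_left _ _)) z hz1
      refine h1.trans ?_
      rcases K with _ | K
      · simp
      have hs' := hs s hst
      -- The sign of `C` is not known; if it is negative, `hC0` forces the power of `|t|` to vanish.
      rcases le_or_gt 0 C with h0 | h0
      · gcongr
      · have ht0 : |t| ^ (K + 1) = 0 := by
          have : 0 ≤ |t| ^ (K + 1) := by positivity
          nlinarith
        have hs0 : |s| ^ (K + 1) = 0 :=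
          le_antisymm (ht0 ▸ by gcongr) (by positivity)
        rw [ht0, hs0]
    have hmv := (convex_uIcc (0 : ℝ) t).norm_image_sub_le_of_norm_hasDerivWithin_le hg hbound
      left_mem_uIcc right_mem_uIcc
    have hg0 : g 0 = 0 := by
      simp only [g]
      rw [Finset.sum_range_succ']
      simp
    rw [hg0, sub_zero, sub_zero, Real.norm_eq_abs] at hmv
    rw [pow_succ, ← mul_assoc]
    exact hmv

lemma hasExpansion_timeDeriv {U : Set (ℝ × E)} (hU : IsOpen U) {f : ℝ × E → F}
    (hf : ContDiffOn ℝ ∞ f U) {x : E} (h : ((0 : ℝ), x) ∈ U) (K : ℕ) :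
    HasExpansion K (fun t => f (t, x)) (fun j => (j ! : ℝ)⁻¹ • timeDeriv^[j] f (0, x)) := by
  obtain ⟨C, δ, hδ, hC⟩ := exists_norm_sub_taylor_le hU hf h K
  refine IsBigO.of_bound C ?_
  filter_upwards [Metric.ball_mem_nhds (0 : ℝ) hδ] with t ht
  rw [norm_pow, Real.norm_eq_abs]
  exact hC t (by simpa using ht) x (Metric.mem_ball_self hδ)

end Expansions

/-! ### Taylor expansion along integral curves -/

section IntegralCurves

open Asymptotics

variable {E : Type*} [NormedAddCommGroup E] [NormedSpace ℝ E] {Ω : Set E}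

/-- A barrier argument: on the ball the speed is less than `r`, so the distance from `x` cannot
overtake `r τ`, and the curve stays in the ball up to time one. -/
lemma norm_sub_le_of_integralCurve {V : E → E} {u : ℝ → E} {x : E} (hu0 : u 0 = x)
    (hu : ∀ τ ∈ Icc (0 : ℝ) 1, HasDerivWithinAt u (V (u τ)) (Icc 0 1) τ) {r b : ℝ} (hr : 0 < r)
    (hb : b < r) (hV : ∀ z ∈ Metric.closedBall x r, ‖V z‖ ≤ b) :
    ∀ τ ∈ Icc (0 : ℝ) 1, u τ ∈ Metric.closedBall x r := by
  have key : ∀ ⦃τ : ℝ⦄, τ ∈ Icc (0 : ℝ) 1 → ‖u τ - x‖ ≤ r * τ := by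
    refine image_norm_le_of_norm_deriv_right_lt_deriv_boundary (f := fun τ => u τ - x)
      (f' := fun τ => V (u τ)) (B' := fun _ => r) ?_ ?_ ?_ ?_ ?_
    · exact ContinuousOn.sub (fun τ hτ => (hu τ hτ).continuousWithinAt) continuousOn_const
    · intro τ hτ
      exact ((hu τ (Ico_subset_Icc_self hτ)).mono_of_mem_nhdsWithin
        (Icc_mem_nhdsGE_of_mem hτ)).sub_const x
    · simp [hu0]
    · intro τ
      simpa using (hasDerivAt_id τ).const_mul r
    · intro τ hτ h
      refine (hV _ ?_).trans_lt hb
      rw [mem_closedBall_iff_norm, h]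
      have := hτ.2.le
      nlinarith
  intro τ hτ
  rw [mem_closedBall_iff_norm]
  refine (key hτ).trans ?_
  have := hτ.2
  nlinarith

variable [hΩ : Fact (IsOpen Ω)]

/-- Along the curve, `d/dτ f(u) = (V f)(u)`, so the remainder for `f` has as derivative the
remainder of one order less for `V f`; the mean value inequality closes the induction. The factor `1
/ M!` is given up, as it is not needed. -/
lemma norm_sub_taylor_integralCurve_le (V : SmoothOn Ω) {K : Set E} (hK : K ⊆ Ω) {u : ℝ → E}
    (hu : ∀ τ ∈ Icc (0 : ℝ) 1, HasDerivWithinAt u (V.1 (u τ)) (Icc 0 1) τ)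
    (huK : ∀ τ ∈ Icc (0 : ℝ) 1, u τ ∈ K) (M : ℕ) (f : SmoothOn Ω) {B : ℝ}
    (hB : ∀ z ∈ K, ‖((vfOp V ^ M) f).1 z‖ ≤ B) :
    ∀ τ ∈ Icc (0 : ℝ) 1, ‖f.1 (u τ) -
      ∑ m ∈ Finset.range M, τ ^ m • ((m ! : ℝ)⁻¹ • ((vfOp V ^ m) f).1 (u 0))‖ ≤ B := by
  induction M generalizing f with
  | zero => intro τ hτ; simpa using hB _ (huK τ hτ)
  | succ M ih =>
    intro τ hτ
    have hB' := ih (vfOp V f) fun z hz => by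
      have := hB z hz
      rwa [pow_succ] at this
    let g : ℝ → E := fun τ => f.1 (u τ) -
      ∑ m ∈ Finset.range (M + 1), τ ^ m • ((m ! : ℝ)⁻¹ • ((vfOp V ^ m) f).1 (u 0))
    have hg : ∀ s ∈ Icc (0 : ℝ) 1, HasDerivWithinAt g ((vfOp V f).1 (u s) -
        ∑ m ∈ Finset.range M, s ^ m • ((m ! : ℝ)⁻¹ • ((vfOp V ^ m) (vfOp V f)).1 (u 0)))
        (Icc 0 1) s := by
      intro s hs
      have hf := ((contDiffAt_of_contDiffOn_isOpen hΩ.out f.2.1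
        (hK (huK s hs))).differentiableAt (by simp)).hasFDerivAt
      have h0 := hf.comp_hasDerivWithinAt s (hu s hs)
      rw [← vfOp_apply _ _ (hK (huK s hs))] at h0
      refine h0.sub ?_
      have h1 : HasDerivAt (fun s : ℝ => ∑ j ∈ Finset.range (M + 1), s ^ j •
          ((j ! : ℝ)⁻¹ • ((vfOp V ^ j) f).1 (u 0))) (∑ j ∈ Finset.range (M + 1),
          (j * s ^ (j - 1) : ℝ) • ((j ! : ℝ)⁻¹ • ((vfOp V ^ j) f).1 (u 0))) s :=
        HasDerivAt.fun_sum fun j _ => (hasDerivAt_pow j s).smul_const _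
      convert h1.hasDerivWithinAt using 1
      rw [Finset.sum_range_succ']
      simp only [Nat.cast_zero, zero_mul, zero_smul, add_zero]
      refine Finset.sum_congr rfl fun j _ => ?_
      rw [smul_smul, smul_smul, Nat.factorial_succ, Nat.add_sub_cancel, pow_succ (vfOp V)]
      congr 1
      push_cast
      field_simp
    have hmv := (convex_Icc (0 : ℝ) 1).norm_image_sub_le_of_norm_hasDerivWithin_le hg hB'
      (left_mem_Icc.2 zero_le_one) hτ
    have hg0 : g 0 = 0 := by
      simp only [g]
      rw [Finset.sum_range_succ']
      simp
    rw [hg0, sub_zero, sub_zero, Real.norm_eq_abs, abs_of_nonneg hτ.1] at hmv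
    have hB0 : 0 ≤ B := (norm_nonneg _).trans (hB' 0 (left_mem_Icc.2 zero_le_one))
    exact hmv.trans (mul_le_of_le_one_right hB0 hτ.2)

omit hΩ in
lemma exists_norm_evalOp_le (P : Polynomial (Module.End ℝ (SmoothOn Ω))) (f : SmoothOn Ω)
    {K : Set E} (hKc : IsCompact K) (hK : K ⊆ Ω) :
    ∃ B, ∀ t : ℝ, |t| ≤ 1 → ∀ z ∈ K, ‖(evalOp t P f).1 z‖ ≤ B := by
  have h : ∀ g : SmoothOn Ω, ∃ B, ∀ z ∈ K, ‖g.1 z‖ ≤ B := fun g =>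
    hKc.exists_bound_of_continuousOn (g.2.1.continuousOn.mono hK)
  choose B hB using h
  refine ⟨∑ k ∈ Finset.range (P.natDegree + 1), B (P.coeff k f), fun t ht z hz => ?_⟩
  rw [evalOp_apply_eq_sum t P f (Nat.lt_succ_self _)]
  simp only [Submodule.coe_sum, Submodule.coe_smul, Finset.sum_apply, Pi.smul_apply]
  refine (norm_sum_le _ _).trans (Finset.sum_le_sum fun k _ => ?_)
  rw [norm_smul, norm_pow, Real.norm_eq_abs]
  exact (mul_le_of_le_one_left (norm_nonneg _) (pow_le_one₀ (abs_nonneg t) ht)).trans (hB _ z hz)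

omit hΩ in
lemma hasExpansion_evalOp (P : Polynomial (Module.End ℝ (SmoothOn Ω))) (f : SmoothOn Ω) (x : E)
    (K : ℕ) : HasExpansion K (fun t => (evalOp t P f).1 x) (fun k => (P.coeff k f).1 x) := by
  refine (hasExpansion_polynomial K (P.natDegree + 1) _ fun k hk => ?_).congr'
    (Eventually.of_forall fun t => ?_)
  · rw [Polynomial.coeff_eq_zero_of_natDegree_lt hk]
    rfl
  · dsimp only
    rw [evalOp_apply_eq_sum t P f (Nat.lt_succ_self _)]
    simp

omit hΩ in
lemma evalOp_expTrunc_apply (t : ℝ) (N : ℕ) (V : Polynomial (Module.End ℝ (SmoothOn Ω)))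
    (f : SmoothOn Ω) (x : E) : (evalOp t (expTrunc N V) f).1 x =
      ∑ m ∈ Finset.range (N + 1), (m ! : ℝ)⁻¹ • ((evalOp t V ^ m) f).1 x := by
  simp only [expTrunc, map_sum, evalOp_smul, map_pow, LinearMap.sum_apply, LinearMap.smul_apply,
    Submodule.coe_sum, Submodule.coe_smul, Finset.sum_apply, Pi.smul_apply]

end IntegralCurves

/-! ### Expansion of a function along the family in terms of the exponential series. -/

section Exponential

open Asymptotics

variable {n : ℕ} {Ω : Set (EuclideanSpace ℝ (Fin n))} [hΩ : Fact (IsOpen Ω)]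

/-- The operator polynomial `∑ t ^ i X_i`. -/
def fieldPoly (N : ℕ) (Y : ℕ → SmoothOn Ω) : Polynomial (Module.End ℝ (SmoothOn Ω)) :=
  ∑ i ∈ Finset.Icc 1 N, Polynomial.monomial i (vfOp (Y i))

/-- The truncated exponential of the operator polynomial `∑ t ^ i X_i`. -/
abbrev expFieldPoly (N : ℕ) (Y : ℕ → SmoothOn Ω) : Polynomial (Module.End ℝ (SmoothOn Ω)) :=
  expTrunc (A := Module.End ℝ (SmoothOn Ω)) N (fieldPoly N Y)

lemma fieldPoly_coeff_zero (N : ℕ) (Y : ℕ → SmoothOn Ω) : (fieldPoly N Y).coeff 0 = 0 := by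
  rw [fieldPoly, Polynomial.finsetSum_coeff]
  refine Finset.sum_eq_zero fun i hi => ?_
  have := (Finset.mem_Icc.1 hi).1
  rw [Polynomial.coeff_monomial, if_neg (by omega)]

lemma evalOp_fieldPoly (t : ℝ) (N : ℕ) (Y : ℕ → SmoothOn Ω) :
    evalOp t (fieldPoly N Y) = vfOp (∑ i ∈ Finset.Icc 1 N, t ^ i • Y i) := by
  simp only [fieldPoly, map_sum, evalOp_monomial, map_smul]

/-- Replacing `γ_t(x)` by the end point of the integral curve costs `O(t^(N+1))` because `f` is
locally Lipschitz. Taylor expansion along that curve gives the truncated exponential, with a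
remainder governed by `V^(N+1) f`, which is divisible by `t^(N+1)`. -/
lemma hasExpansion_of_isExpModulo
    {γ : ℝ → EuclideanSpace ℝ (Fin n) → EuclideanSpace ℝ (Fin n)}
    {X : ℕ → EuclideanSpace ℝ (Fin n) → EuclideanSpace ℝ (Fin n)} {N : ℕ}
    (hγ : IsExpModulo Ω γ X N) {Y : ℕ → SmoothOn Ω}
    (hY : ∀ i ∈ Finset.Icc 1 N, EqOn (Y i).1 (X i) Ω) (f : SmoothOn Ω)
    {x : EuclideanSpace ℝ (Fin n)} (hx : x ∈ Ω) (hc : Tendsto (fun t => γ t x) (𝓝 0) (𝓝 x)) :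
    HasExpansion (N + 1) (fun t => f.1 (γ t x))
      (fun k => ((expFieldPoly N Y).coeff k f).1 x) := by
  obtain ⟨C, hC⟩ := hγ x hx
  obtain ⟨L, s, hs, hL⟩ := ((contDiffAt_of_contDiffOn_isOpen hΩ.out f.2.1 hx).of_le
    (by simp : (1 : WithTop ℕ∞) ≤ ∞)).exists_lipschitzOnWith
  obtain ⟨r, hr, hrs⟩ := Metric.nhds_basis_closedBall.mem_iff.1
    (inter_mem hs (hΩ.out.mem_nhds hx))
  have hKΩ : Metric.closedBall x r ⊆ Ω := fun z hz => (hrs hz).2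
  have hKc : IsCompact (Metric.closedBall x r) := isCompact_closedBall x r
  -- `V'` is the quotient of `V` by `t` and gives `V = O(t)`, which confines the curve to the ball;
  -- `Q`, the quotient of `V^(N+1)` by `t^(N+1)`, controls the Taylor remainder.
  obtain ⟨V', hV'⟩ := pow_eq_X_pow_mul (A := Module.End ℝ (SmoothOn Ω))
    (fieldPoly_coeff_zero N Y) 1
  obtain ⟨Q, hQ⟩ := pow_eq_X_pow_mul (A := Module.End ℝ (SmoothOn Ω))
    (fieldPoly_coeff_zero N Y) (N + 1)
  obtain ⟨b, hb⟩ := exists_norm_evalOp_le V' (idOn Ω) hKc hKΩ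
  obtain ⟨B, hB⟩ := exists_norm_evalOp_le Q f hKc hKΩ
  have hpow : ∀ (t : ℝ) (k : ℕ) (P : Polynomial (Module.End ℝ (SmoothOn Ω))) (g : SmoothOn Ω)
      (z : EuclideanSpace ℝ (Fin n)), (evalOp t (Polynomial.X ^ k * P) g).1 z =
        t ^ k • (evalOp t P g).1 z := by
    intro t k P g z
    rw [map_mul, evalOp_X_pow, smul_mul_assoc, one_mul]
    rfl
  have hsmall : ∀ᶠ t : ℝ in 𝓝 0, |t| * b < r := by
    have : Tendsto (fun t : ℝ => |t| * b) (𝓝 0) (𝓝 (|(0 : ℝ)| * b)) :=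
      (continuous_abs.mul continuous_const).tendsto 0
    rw [abs_zero, zero_mul] at this
    exact this.eventually_lt_const hr
  have hone : ∀ᶠ t : ℝ in 𝓝 0, |t| ≤ 1 := by
    filter_upwards [Metric.closedBall_mem_nhds (0 : ℝ) one_pos] with t ht
    simpa using ht
  have hbound : ∀ᶠ t : ℝ in 𝓝 0,
      ‖f.1 (γ t x) - (evalOp t (expFieldPoly N Y) f).1 x‖ ≤
        (L * C + B) * ‖t ^ (N + 1)‖ := by
    filter_upwards [hC, hsmall, hone, hc.eventually_mem (Metric.closedBall_mem_nhds x hr)]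
      with t ⟨y, ⟨u, hu0, hu1, huΩ, hu⟩, hy⟩ ht ht1 hγt
    set V : SmoothOn Ω := ∑ i ∈ Finset.Icc 1 N, t ^ i • Y i with hVdef
    have hVX : ∀ z ∈ Ω, V.1 z = ∑ i ∈ Finset.Icc 1 N, t ^ i • X i z := by
      intro z hz
      simp only [hVdef, Submodule.coe_sum, Submodule.coe_smul, Finset.sum_apply, Pi.smul_apply]
      exact Finset.sum_congr rfl fun i hi => by rw [hY i hi hz]
    have hu' : ∀ τ ∈ Icc (0 : ℝ) 1, HasDerivWithinAt u (V.1 (u τ)) (Icc 0 1) τ := by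
      intro τ hτ
      rw [hVX _ (huΩ τ hτ)]
      exact hu τ hτ
    have hVb : ∀ z ∈ Metric.closedBall x r, ‖V.1 z‖ ≤ |t| * b := by
      intro z hz
      rw [← vfOp_idOn V, ← evalOp_fieldPoly, ← pow_one (fieldPoly N Y), hV', hpow, norm_smul,
        pow_one, Real.norm_eq_abs]
      exact mul_le_mul_of_nonneg_left (hb t ht1 z hz) (abs_nonneg t)
    have huK := norm_sub_le_of_integralCurve hu0 hu' hr ht hVb
    have hyK : y ∈ Metric.closedBall x r := hu1 ▸ huK 1 (right_mem_Icc.2 zero_le_one)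
    have h1 := norm_sub_taylor_integralCurve_le V hKΩ hu' huK (N + 1) f
      (B := |t| ^ (N + 1) * B) (by
        intro z hz
        rw [← evalOp_fieldPoly, ← map_pow, hQ, hpow, norm_smul, norm_pow, Real.norm_eq_abs]
        exact mul_le_mul_of_nonneg_left (hB t ht1 z hz) (by positivity)) 1
      (right_mem_Icc.2 zero_le_one)
    rw [hu0, hu1] at h1
    simp only [one_pow, one_smul] at h1
    have h2 : ‖f.1 (γ t x) - f.1 y‖ ≤ L * (C * |t| ^ (N + 1)) :=
      (hL.norm_sub_le (hrs hγt).1 (hrs hyK).1).trans (mul_le_mul_of_nonneg_left hy L.2)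
    rw [evalOp_expTrunc_apply, evalOp_fieldPoly, norm_pow, Real.norm_eq_abs]
    calc _ ≤ ‖f.1 (γ t x) - f.1 y‖ + _ := norm_sub_le_norm_sub_add_norm_sub _ (f.1 y) _
      _ ≤ L * (C * |t| ^ (N + 1)) + |t| ^ (N + 1) * B := add_le_add h2 h1
      _ = _ := by ring
  have h3 := (hasExpansion_evalOp (expFieldPoly N Y) f x (N + 1)).add_isBigO
    (IsBigO.of_bound _ hbound)
  refine h3.congr' (Eventually.of_forall fun t => ?_)
  dsimp only
  abel

end Exponential

/-! ### The pullback curve -/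

section Inverse

/-- The global smooth inverse of an injective local diffeomorphism. -/
lemma exists_smooth_inverse {F G : Type*} [NormedAddCommGroup F] [NormedSpace ℝ F]
    [CompleteSpace F] [NormedAddCommGroup G] [NormedSpace ℝ G] {f : F → G} {U : Set F}
    (hU : IsOpen U) (hf : ContDiffOn ℝ ∞ f U) (hinj : InjOn f U)
    (hinv : ∀ p ∈ U, (fderiv ℝ f p).IsInvertible) :
    ∃ g : G → F, IsOpen (f '' U) ∧ ContDiffOn ℝ ∞ g (f '' U) ∧ ∀ p ∈ U, g (f p) = p := by
  have hleft : ∀ p ∈ U, Function.invFunOn f U (f p) = p := fun p hp =>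
    hinj.leftInvOn_invFunOn hp
  have key : ∀ p ∈ U, f '' U ∈ 𝓝 (f p) ∧ ContDiffAt ℝ ∞ (Function.invFunOn f U) (f p) := by
    intro p hp
    obtain ⟨e, he⟩ := hinv p hp
    have hc := contDiffAt_of_contDiffOn_isOpen hU hf hp
    have hd : HasFDerivAt f (e : F →L[ℝ] G) p :=
      he ▸ (hc.differentiableAt (by simp)).hasFDerivAt
    have hs := hc.hasStrictFDerivAt' hd (by simp)
    refine ⟨?_, ?_⟩
    · rw [← hs.map_nhds_eq_of_equiv]
      exact image_mem_map (hU.mem_nhds hp)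
    · refine (hc.to_localInverse hd (by simp)).congr_of_eventuallyEq ?_
      refine hs.localInverse_unique ?_
      filter_upwards [hU.mem_nhds hp] with q hq using hleft q hq
  refine ⟨Function.invFunOn f U, ?_, ?_, hleft⟩
  · rw [isOpen_iff_mem_nhds]
    rintro _ ⟨p, hp, rfl⟩
    exact (key p hp).1
  · rintro _ ⟨p, hp, rfl⟩
    exact (key p hp).2.contDiffWithinAt

end Inverse

section PullbackCurve

variable {n : ℕ} {Ω : Set (EuclideanSpace ℝ (Fin n))} {I : Set ℝ}
  {γ : ℝ → EuclideanSpace ℝ (Fin n) → EuclideanSpace ℝ (Fin n)}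

lemma IsDiffeoFamily.isOpen_prod (h : IsDiffeoFamily Ω I γ) : IsOpen (I ×ˢ Ω) :=
  h.isOpen_interval.prod h.isOpen_domain

/-- The derivative of `(t, x) ↦ (t, γ_t(x))` is block triangular with diagonal blocks `1` and
`Dγ_t`, hence injective, and finite dimension gives the inverse. -/
lemma IsDiffeoFamily.isInvertible_fderiv (h : IsDiffeoFamily Ω I γ)
    {p : ℝ × EuclideanSpace ℝ (Fin n)} (hp : p ∈ I ×ˢ Ω) :
    (fderiv ℝ (fun p : ℝ × EuclideanSpace ℝ (Fin n) => (p.1, γ p.1 p.2)) p).IsInvertible := by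
  have hd := ((contDiffAt_of_contDiffOn_isOpen h.isOpen_prod h.smooth hp).differentiableAt
    (by simp)).hasFDerivAt
  have hΦ := (hasFDerivAt_fst (𝕜 := ℝ) (p := p)).prodMk hd
  rw [hΦ.fderiv]
  set D := fderiv ℝ (fun p : ℝ × EuclideanSpace ℝ (Fin n) => γ p.1 p.2) p
  have hγ : fderiv ℝ (γ p.1) p.2 = D.comp (ContinuousLinearMap.inr ℝ ℝ _) :=
    (HasFDerivAt.comp (f := fun z => (p.1, z)) p.2 hd (hasFDerivAt_prodMk_right p.1 p.2)).fderiv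
  have hinj : Function.Injective ((ContinuousLinearMap.fst ℝ ℝ _).prod D :
      ℝ × EuclideanSpace ℝ (Fin n) →L[ℝ] ℝ × EuclideanSpace ℝ (Fin n)) := by
    rw [injective_iff_map_eq_zero]
    rintro ⟨a, v⟩ hv
    obtain ⟨h1, h2⟩ := Prod.mk.inj hv
    obtain rfl : a = 0 := h1
    obtain ⟨e, he⟩ := h.fderiv_invertible p.1 hp.1 p.2 hp.2
    have h3 : e v = 0 := by
      have : (e : _ →L[ℝ] _) v = D (0, v) := by rw [he, hγ]; rfl
      exact this.trans h2
    rw [e.map_eq_zero_iff.1 h3]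
    rfl
  exact ⟨(LinearEquiv.ofInjectiveEndo _ hinj).toContinuousLinearEquiv, by ext <;> rfl⟩

/-- The time-dependent vector field that generates the family `γ`, and its relation to the
curves `Γ_R`. -/
lemma IsDiffeoFamily.exists_velocity (h : IsDiffeoFamily Ω I γ) :
    ∃ (U : Set (ℝ × EuclideanSpace ℝ (Fin n)))
      (W : ℝ × EuclideanSpace ℝ (Fin n) → EuclideanSpace ℝ (Fin n)),
      IsOpen U ∧ ContDiffOn ℝ ∞ W U ∧ (∀ x ∈ Ω, ((0 : ℝ), x) ∈ U) ∧
      (∀ t ∈ I, ∀ x ∈ Ω,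
        W (t, γ t x) = timeDeriv (fun p : ℝ × EuclideanSpace ℝ (Fin n) => γ p.1 p.2) (t, x)) ∧
      ∀ x ∈ Ω, GammaR Ω γ x =ᶠ[𝓝 0] fun t => W (t, x) := by
  have hsmooth : ContDiffOn ℝ ∞ (fun p : ℝ × EuclideanSpace ℝ (Fin n) => (p.1, γ p.1 p.2))
      (I ×ˢ Ω) := contDiff_fst.contDiffOn.prodMk h.smooth
  have hinj : InjOn (fun p : ℝ × EuclideanSpace ℝ (Fin n) => (p.1, γ p.1 p.2)) (I ×ˢ Ω) := by
    rintro ⟨t, x⟩ hp ⟨s, y⟩ hq he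
    obtain ⟨h1, h2⟩ := Prod.mk.inj he
    dsimp only at h1 h2
    subst h1
    exact Prod.ext rfl (h.injOn t hp.1 hp.2 hq.2 h2)
  obtain ⟨Ψ, hopen, hΨ, hleft⟩ := exists_smooth_inverse h.isOpen_prod hsmooth hinj
    fun p hp => h.isInvertible_fderiv hp
  have hW : ∀ t ∈ I, ∀ x ∈ Ω, (timeDeriv (fun p : ℝ × EuclideanSpace ℝ (Fin n) => γ p.1 p.2) ∘ Ψ)
      (t, γ t x) = timeDeriv (fun p : ℝ × EuclideanSpace ℝ (Fin n) => γ p.1 p.2) (t, x) := by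
    intro t ht x hx
    exact congrArg _ (hleft (t, x) ⟨ht, hx⟩)
  have h0 : ∀ x ∈ Ω, ((0 : ℝ), x) ∈
      (fun p : ℝ × EuclideanSpace ℝ (Fin n) => (p.1, γ p.1 p.2)) '' (I ×ˢ Ω) := fun x hx =>
    ⟨(0, x), ⟨h.zero_mem, hx⟩, by simp [h.map_zero x hx]⟩
  -- `W` is `∂_t γ` composed with the inverse of `(t, x) ↦ (t, γ_t(x))`, defined on the open image
  -- of that map.
  refine ⟨_, _, hopen, (contDiffOn_timeDeriv h.isOpen_prod h.smooth).comp hΨ ?_, h0, hW, ?_⟩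
  · rintro _ ⟨p, hp, rfl⟩
    exact (hleft p hp).symm ▸ hp
  · intro x hx
    -- For small `t` the point `x` lies in `γ_t(Ω)`, so `Function.invFunOn` returns its true
    -- preimage.
    have hev : ∀ᶠ t : ℝ in 𝓝 0, (t, x) ∈
        (fun p : ℝ × EuclideanSpace ℝ (Fin n) => (p.1, γ p.1 p.2)) '' (I ×ˢ Ω) :=
      (Continuous.prodMk_left x).continuousAt.eventually_mem (hopen.mem_nhds (h0 x hx))
    filter_upwards [hev] with t ⟨⟨s, y⟩, hsy, he⟩
    obtain ⟨h1, h2⟩ := Prod.mk.inj he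
    dsimp only at h1 h2
    subst h1
    obtain ⟨ht, hy⟩ := hsy
    rw [← h2, hW s ht y hy, GammaR, (h.injOn s ht).leftInvOn_invFunOn hy]
    have h3 := hasDerivAt_timeDeriv h.isOpen_prod h.smooth
      (show (s, y) ∈ I ×ˢ Ω from ⟨ht, hy⟩)
    have h4 : HasDerivAt (fun r => γ (r + s) y)
        (timeDeriv (fun p : ℝ × EuclideanSpace ℝ (Fin n) => γ p.1 p.2) (s, y)) 0 :=
      HasDerivAt.comp_add_const 0 s (by rw [zero_add]; exact h3)
    exact h4.deriv

end PullbackCurve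

/-! ### The pullback condition and the bracket condition -/

section Main

open Asymptotics

variable {n : ℕ} {Ω : Set (EuclideanSpace ℝ (Fin n))} {I : Set ℝ}
  {γ : ℝ → EuclideanSpace ℝ (Fin n) → EuclideanSpace ℝ (Fin n)}
  {X : ℕ → EuclideanSpace ℝ (Fin n) → EuclideanSpace ℝ (Fin n)} {N : ℕ}

/-- This makes both recursions below triangular, with leading coefficient one. -/
lemma expFieldPoly_coeff_zero [hΩ : Fact (IsOpen Ω)] (N : ℕ) (Y : ℕ → SmoothOn Ω) :
    (expFieldPoly N Y).coeff 0 = 1 := by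
  rw [expFieldPoly, expTrunc, Polynomial.finsetSum_coeff, Finset.sum_range_succ',
    Finset.sum_eq_zero, zero_add]
  · simp
  · intro m _
    obtain ⟨W, hW⟩ := pow_eq_X_pow_mul (A := Module.End ℝ (SmoothOn Ω))
      (fieldPoly_coeff_zero N Y) (m + 1)
    rw [hW, Polynomial.coeff_smul, Polynomial.coeff_X_pow_mul', if_neg (by omega), smul_zero]

/-- The recursion for the Taylor coefficients of the generating vector field. -/
lemma IsDiffeoFamily.succ_smul_coeff_eq_sum [hΩ : Fact (IsOpen Ω)] (h : IsDiffeoFamily Ω I γ)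
    (hγ : IsExpModulo Ω γ X N) {Y : ℕ → SmoothOn Ω}
    (hY : ∀ i ∈ Finset.Icc 1 N, EqOn (Y i).1 (X i) Ω)
    {U : Set (ℝ × EuclideanSpace ℝ (Fin n))}
    {W : ℝ × EuclideanSpace ℝ (Fin n) → EuclideanSpace ℝ (Fin n)} (hU : IsOpen U)
    (hW : ContDiffOn ℝ ∞ W U) (hU0 : ∀ x ∈ Ω, ((0 : ℝ), x) ∈ U)
    (hWγ : ∀ t ∈ I, ∀ x ∈ Ω,
      W (t, γ t x) = timeDeriv (fun p : ℝ × EuclideanSpace ℝ (Fin n) => γ p.1 p.2) (t, x))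
    {w : ℕ → SmoothOn Ω}
    (hw : ∀ j, EqOn (w j).1 (fun x => (j ! : ℝ)⁻¹ • timeDeriv^[j] W (0, x)) Ω)
    {k : ℕ} (hk : k < N) :
    ((k : ℝ) + 1) • (expFieldPoly N Y).coeff (k + 1) (idOn Ω) =
      ∑ j ∈ Finset.range (k + 1), (expFieldPoly N Y).coeff (k - j) (w j) := by
  refine SmoothOn.ext_on fun x hx => ?_
  have hx0 : ((0 : ℝ), x) ∈ I ×ˢ Ω := ⟨h.zero_mem, hx⟩
  have hc : Tendsto (fun t => γ t x) (𝓝 0) (𝓝 x) := by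
    have h1 := (hasDerivAt_timeDeriv h.isOpen_prod h.smooth hx0).continuousAt.tendsto
    simp only [h.map_zero x hx] at h1
    exact h1
  have hcΩ : ∀ᶠ t in 𝓝 0, γ t x ∈ Ω := hc.eventually_mem (h.isOpen_domain.mem_nhds hx)
  -- the coefficients of the curve itself
  have hE : ∀ k < N + 1, ((expFieldPoly N Y).coeff k (idOn Ω)).1 x = (k ! : ℝ)⁻¹ •
      timeDeriv^[k] (fun p : ℝ × EuclideanSpace ℝ (Fin n) => γ p.1 p.2) (0, x) := by
    intro k hk
    refine HasExpansion.unique ((hasExpansion_of_isExpModulo hγ hY (idOn Ω) hx hc).congr' ?_)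
      (hasExpansion_timeDeriv h.isOpen_prod h.smooth hx0 (N + 1)) hk
    filter_upwards [hcΩ] with t ht using idOn_apply ht
  have hleft := hasExpansion_timeDeriv h.isOpen_prod
    (contDiffOn_timeDeriv h.isOpen_prod h.smooth) hx0 N
  -- the expansion of the generating field along the curve
  obtain ⟨C, δ, hδ, hC⟩ := exists_norm_sub_taylor_le hU hW (hU0 x hx) N
  have hsum : HasExpansion N (∑ j ∈ Finset.range N, fun t => t ^ j • (w j).1 (γ t x))
      (∑ j ∈ Finset.range N,
        fun k => if j ≤ k then ((expFieldPoly N Y).coeff (k - j) (w j)).1 x else 0) :=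
    HasExpansion.sum _ fun j _ =>
      ((hasExpansion_of_isExpModulo hγ hY (w j) hx hc).of_le (Nat.le_succ N)).pow_smul j
  -- Here the Taylor bound must be uniform in the space variable, since the base point `γ t x` moves
  -- with `t`.
  have hrem : (fun t => W (t, γ t x) -
      (∑ j ∈ Finset.range N, fun t => t ^ j • (w j).1 (γ t x)) t) =O[𝓝 0] fun t => t ^ N := by
    refine IsBigO.of_bound C ?_
    filter_upwards [hcΩ, hc.eventually_mem (Metric.ball_mem_nhds x hδ),
      Metric.ball_mem_nhds (0 : ℝ) hδ] with t ht htδ ht0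
    rw [norm_pow, Real.norm_eq_abs, Finset.sum_apply]
    refine le_trans (le_of_eq ?_) (hC t (by simpa using ht0) _ htδ)
    congr 2
    exact Finset.sum_congr rfl fun j _ => by rw [hw j ht]
  have hright := (hsum.add_isBigO hrem).congr' (g' := fun t =>
      timeDeriv (fun p : ℝ × EuclideanSpace ℝ (Fin n) => γ p.1 p.2) (t, x)) (by
    filter_upwards [h.isOpen_interval.mem_nhds h.zero_mem] with t ht
    rw [← hWγ t ht x hx]
    abel)
  have huniq := hleft.unique hright hk
  simp only [Submodule.coe_smul, Submodule.coe_sum, Finset.sum_apply, Pi.smul_apply]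
  rw [hE (k + 1) (by omega)]
  rw [Finset.sum_apply] at huniq
  rw [Function.iterate_succ_apply, smul_smul, Nat.factorial_succ]
  have hfac : ((k : ℝ) + 1) * (((k + 1) * k ! : ℕ) : ℝ)⁻¹ = (k ! : ℝ)⁻¹ := by
    push_cast
    field_simp
  rw [hfac, huniq]
  symm
  refine Finset.sum_subset_zero_on_sdiff (Finset.range_mono hk) (fun j hj => ?_) fun j hj => ?_
  · rw [if_neg]
    have := (Finset.mem_sdiff.1 hj).2
    rw [Finset.mem_range] at this
    omega
  · rw [if_pos (Nat.lt_succ_iff.1 (Finset.mem_range.1 hj))]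

/-- The recursion for the coefficients of the logarithmic derivative. -/
lemma succ_smul_coeff_expFieldPoly [hΩ : Fact (IsOpen Ω)] (Y : ℕ → SmoothOn Ω) {k : ℕ}
    (hk : k < N) :
    ((k : ℝ) + 1) • (expFieldPoly N Y).coeff (k + 1) (idOn Ω) =
      ∑ j ∈ Finset.range (k + 1), (expFieldPoly N Y).coeff (k - j)
        ((logDerivTrunc (A := Module.End ℝ (SmoothOn Ω)) N (fieldPoly N Y)).coeff j (idOn Ω)) := by
  have h := coeff_derivative_expTrunc (A := Module.End ℝ (SmoothOn Ω))
    (fieldPoly_coeff_zero N Y) hk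
  -- The antidiagonal sum is reflected so that `j` indexes the logarithmic derivative.
  rw [Polynomial.coeff_derivative, Polynomial.coeff_mul,
    Finset.Nat.sum_antidiagonal_eq_sum_range_succ_mk, ← Finset.sum_range_reflect] at h
  have h2 := congrArg (fun T : Module.End ℝ (SmoothOn Ω) => T (idOn Ω)) h
  have h3 : (((expFieldPoly N Y).coeff (k + 1)) * ((k : Module.End ℝ (SmoothOn Ω)) + 1)) (idOn Ω) =
      ((k : ℝ) + 1) • (expFieldPoly N Y).coeff (k + 1) (idOn Ω) := by
    rw [Module.End.mul_apply, LinearMap.add_apply, Module.End.natCast_apply, Module.End.one_apply,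
      map_add, map_nsmul, add_smul, one_smul, Nat.cast_smul_eq_nsmul]
  rw [← h3]
  refine h2.trans ?_
  rw [LinearMap.sum_apply]
  refine Finset.sum_congr rfl fun j hj => ?_
  have hj' := Finset.mem_range.1 hj
  have e1 : k.succ - 1 - j = k - j := by omega
  have e2 : k - (k - j) = j := by omega
  rw [e1, e2]
  rfl

/-- The Taylor coefficients of the curve `Γ_R` are the modified vector fields. -/
theorem iteratedDeriv_GammaR (h : IsDiffeoFamily Ω I γ)
    (hX : ∀ i ∈ Finset.Icc 1 N, ContDiffOn ℝ ∞ (X i) Ω) (hγ : IsExpModulo Ω γ X N)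
    {x : EuclideanSpace ℝ (Fin n)} (hx : x ∈ Ω) {k : ℕ} (hk : k < N) :
    iteratedDeriv k (GammaR Ω γ x) 0 = ((k + 1)! : ℝ) • hatField X (k + 1) x := by
  have hΩ : Fact (IsOpen Ω) := ⟨h.isOpen_domain⟩
  obtain ⟨U, W, hU, hW, hU0, hWγ, hGamma⟩ := h.exists_velocity
  have hYex : ∀ i, ∃ Y : SmoothOn Ω, i ∈ Finset.Icc 1 N → EqOn Y.1 (X i) Ω := fun i => by
    by_cases hi : i ∈ Finset.Icc 1 N
    · exact ⟨SmoothOn.mk _ (hX i hi), fun _ x hx => SmoothOn.mk_apply _ hx⟩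
    · exact ⟨0, fun h => absurd h hi⟩
  choose Y hY using hYex
  have hwex : ∀ j, ∃ w : SmoothOn Ω,
      EqOn w.1 (fun x => (j ! : ℝ)⁻¹ • timeDeriv^[j] W (0, x)) Ω := fun j => by
    have hs : ContDiffOn ℝ ∞ (fun x => (j ! : ℝ)⁻¹ • timeDeriv^[j] W (0, x)) Ω :=
      ((contDiffOn_timeDeriv_iterate hU hW j).comp (contDiff_prodMk_right 0).contDiffOn
        hU0).const_smul _
    exact ⟨SmoothOn.mk _ hs, fun x hx => SmoothOn.mk_apply _ hx⟩
  choose w hw using hwex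
  -- Both sequences solve the same recursion; after cancelling the earlier terms, only the one with
  -- `E_0 = 1` remains.
  have key : ∀ k < N, w k =
      (logDerivTrunc (A := Module.End ℝ (SmoothOn Ω)) N (fieldPoly N Y)).coeff k (idOn Ω) := by
    intro k
    induction k using Nat.strong_induction_on with
    | _ k ih =>
    intro hk
    have h1 := h.succ_smul_coeff_eq_sum hγ hY hU hW hU0 hWγ hw hk
    rw [succ_smul_coeff_expFieldPoly Y hk, Finset.sum_range_succ, Finset.sum_range_succ,
      Finset.sum_congr rfl fun j hj => by
        rw [← ih j (Finset.mem_range.1 hj) ((Finset.mem_range.1 hj).trans hk)]] at h1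
    have h2 := add_left_cancel h1
    rw [Nat.sub_self, expFieldPoly_coeff_zero] at h2
    exact h2.symm
  rw [(hGamma x hx).iteratedDeriv_eq k, iteratedDeriv_eq_timeDeriv hU hW k (hU0 x hx)]
  have h3 := hw k hx
  have h4 := coeff_logDerivTrunc_vfOp X Y hY (k := k + 1) (by omega) hk hx
  rw [key k hk] at h3
  -- The shift by one arises because coefficient `k` of the logarithmic derivative is `(k + 1)
  -- X̂_(k+1)`; with `k!` from Taylor's formula this gives `(k + 1)!`.
  have h5 : (k ! : ℝ)⁻¹ • timeDeriv^[k] W (0, x) = ((k + 1 : ℕ) : ℝ) • hatField X (k + 1) x :=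
    h3.symm.trans h4
  rw [inv_smul_eq_iff₀ (Nat.cast_ne_zero.2 (Nat.factorial_ne_zero k)), smul_smul] at h5
  rw [h5, Nat.factorial_succ]
  push_cast
  rw [mul_comm]

/-- The pullback condition and the bracket condition are equivalent. -/
theorem pullbackCondition_iff_bracketCondition (hnN : n ≤ N) (h : IsDiffeoFamily Ω I γ)
    (hX : ∀ i ∈ Finset.Icc 1 N, ContDiffOn ℝ ∞ (X i) Ω) (hγ : IsExpModulo Ω γ X N)
    {x : EuclideanSpace ℝ (Fin n)} (hx : x ∈ Ω) :
    PullbackCondition Ω γ x ↔ BracketCondition X x := by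
  have h1 : (fun ν : Fin n => iteratedDeriv (ν : ℕ) (GammaR Ω γ x) 0) =
      (fun ν : Fin n => Units.mk0 (((ν + 1 : ℕ)! : ℝ))
        (Nat.cast_ne_zero.2 (Nat.factorial_ne_zero _))) •
        fun ν : Fin n => hatField X ((ν : ℕ) + 1) x := by
    funext ν
    exact iteratedDeriv_GammaR h hX hγ hx (ν.2.trans_le hnN)
  rw [PullbackCondition, h1, LinearIndependent.units_smul_iff]
  rfl

end Main

end CurveFamily

end

theorem mainTheorem3 (n : ℕ) :
    (∀ (N : ℕ) (Ω : Set (EuclideanSpace ℝ (Fin n))) (I : Set ℝ)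
        (γ : ℝ → EuclideanSpace ℝ (Fin n) → EuclideanSpace ℝ (Fin n))
        (X : ℕ → EuclideanSpace ℝ (Fin n) → EuclideanSpace ℝ (Fin n)),
        n ≤ N →
        CurveFamily.IsDiffeoFamily Ω I γ →
        (∀ i ∈ Finset.Icc 1 N, ContDiffOn ℝ ∞ (X i) Ω) →
        CurveFamily.IsExpModulo Ω γ X N →
        ∀ x ∈ Ω, (CurveFamily.PullbackCondition Ω γ x ↔ CurveFamily.BracketCondition X x)) ∧
    (∀ (X : ℕ → EuclideanSpace ℝ (Fin n) → EuclideanSpace ℝ (Fin n))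
        (x : EuclideanSpace ℝ (Fin n)),
        CurveFamily.hatField X 1 x = X 1 x ∧
        CurveFamily.hatField X 2 x = X 2 x ∧
        CurveFamily.hatField X 3 x =
          X 3 x - (1 / 6 : ℝ) • VectorField.lieBracket ℝ (X 1) (X 2) x ∧
        CurveFamily.hatField X 4 x =
          X 4 x - (1 / 4 : ℝ) • VectorField.lieBracket ℝ (X 1) (X 3) x
            + (1 / 24 : ℝ) •
              VectorField.lieBracket ℝ (X 1) (VectorField.lieBracket ℝ (X 1) (X 2)) x ∧
        CurveFamily.hatField X 5 x =
          X 5 x - (3 / 10 : ℝ) • VectorField.lieBracket ℝ (X 1) (X 4) x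
            - (1 / 10 : ℝ) • VectorField.lieBracket ℝ (X 2) (X 3) x
            + (1 / 15 : ℝ) •
              VectorField.lieBracket ℝ (X 1) (VectorField.lieBracket ℝ (X 1) (X 3)) x
            + (1 / 30 : ℝ) •
              VectorField.lieBracket ℝ (X 2) (VectorField.lieBracket ℝ (X 1) (X 2)) x
            - (1 / 120 : ℝ) •
              VectorField.lieBracket ℝ (X 1)
                (VectorField.lieBracket ℝ (X 1) (VectorField.lieBracket ℝ (X 1) (X 2))) x) := by
  exact ⟨fun _ _ _ _ _ hnN h hX hγ _ hx =>
      CurveFamily.pullbackCondition_iff_bracketCondition hnN h hX hγ hx,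
    fun X x => ⟨CurveFamily.hatField_one X x, CurveFamily.hatField_two X x,
      CurveFamily.hatField_three X x, CurveFamily.hatField_four X x,
      CurveFamily.hatField_five X x⟩⟩
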